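/- Let $S\subset\mathbb{C}$ be a finite set with at least two points. Put $c_0=\frac{1}{\#S}\sum_{s\in S}s$, and let $s_1',\ldots,s_6'$ be the vertices of a regular hexagon (in any rotational position) inscribed in the circle with centre $c_0$ and radius $2\max_{s\in S}|s-c_0|$. Put $S'=S\cup\{s_1',\ldots,s_6'\}$, and for $s\in S'$ let $$F_s=\{x\in\mathbb{C} : |x-s|\le|x-t| \text{ for all } t\in S'\}$$ be its Voronoi cell; put $F_\infty=\bigcup_{s\in S'\setminus S}F_s$. Let $(V,E)$ be the graph whose vertex set $V\subset\mathbb{C}$ consists of the points lying in at least three of the cells $F_s$, $s\in S'$, and in which distinct $v,w\in V$ are joined by an edge if the line segment $[v,w]$ equals $F_s\cap F_t$ for some distinct $s,t\in S'$. Vertices and edges of this graph avoid $S$, so every walk in the graph defines a piecewise linear path in $\mathbb{C}-S$. Then: 1. For every $s\in S\cup\{\infty\}$ there is a simple cycle $\gamma_s$ in $(V,E)$ whose trace is exactly the boundary of $F_s$, and these cycles can be chosen so that the classes of the loops $\gamma_s$, $s\in S\cup\{\infty\}$, generate the singular homology group $H_1(\mathbb{C}-S,\mathbb{Z})$. (The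 simple cycle $\gamma_s$ is determined by its trace up to starting point and orientation.) 2. For every $v\in V$, the fundamental group $\pi_1(\mathbb{C}-S,v)$ is generated by the homotopy classes of the loops given by closed walks in $(V,E)$ that begin and end at $v$. -/

import Mathlib

open scoped unitInterval NNReal

noncomputable section

namespace VoronoiCycles

/-! ### Singular homology class of a loop -/

section Homology

open CategoryTheory Simplicial

/-- The singular homology group `H₁(X, ℤ)`. -/
abbrev H1 (X : Type) [TopologicalSpace X] : ModuleCat.{0} ℤ :=
  ((AlgebraicTopology.singularHomologyFunctor (ModuleCat.{0} ℤ) 1).obj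
    (ModuleCat.of ℤ ℤ)).obj (TopCat.of X)

/-- A path, regarded as a singular `1`-simplex. -/
def pathSimplex {X : Type} [TopologicalSpace X] {x y : X} (γ : Path x y) :
    (TopCat.toSSet.obj (TopCat.of X)) _⦋1⦌ :=
  ((TopCat.of X).toSSetObjEquiv (.op ⦋1⦌)).symm
    (γ.toContinuousMap.comp
      ⟨stdSimplexHomeomorphUnitInterval, stdSimplexHomeomorphUnitInterval.continuous⟩)

/-- A loop, regarded as a singular `1`-simplex, is a cycle. -/
theorem pathSimplex_isCycle {X : Type} [TopologicalSpace X] {x : X} (γ : Path x x) :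
    (TopCat.toSSet.obj (TopCat.of X)).ιChainComplex (R := ModuleCat.of ℤ ℤ) (pathSimplex γ) ≫
      ((TopCat.toSSet.obj (TopCat.of X)).chainComplex (ModuleCat.of ℤ ℤ)).d 1 0 = 0 := by
  have h : (TopCat.toSSet.obj (TopCat.of X)).δ 0 (pathSimplex γ) =
      (TopCat.toSSet.obj (TopCat.of X)).δ 1 (pathSimplex γ) := by
    apply ((TopCat.of X).toSSetObjEquiv (.op ⦋0⦌)).injective
    refine ContinuousMap.ext fun z => ?_
    obtain rfl : z = stdSimplex.vertex 0 := Subsingleton.elim (α := stdSimplex ℝ (Fin 1)) _ _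
    refine (TopCat.toSSetObjEquiv_δ_apply (pathSimplex γ) 0 (stdSimplex.vertex 0)).trans
      (Eq.trans ?_
        (TopCat.toSSetObjEquiv_δ_apply (pathSimplex γ) 1 (stdSimplex.vertex 0)).symm)
    rw [stdSimplex.map_vertex, stdSimplex.map_vertex]
    exact γ.target.trans γ.source.symm
  simp [Fin.sum_univ_two, h]

/-- The class in `H₁(X, ℤ)` of a loop `γ`, i.e. the class of the singular `1`-cycle `1 • γ`. -/
def loopClass {X : Type} [TopologicalSpace X] {x : X} (γ : Path x x) : H1 X :=
  (HomologicalComplex.liftCycles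
      ((TopCat.toSSet.obj (TopCat.of X)).chainComplex (ModuleCat.of ℤ ℤ))
      ((TopCat.toSSet.obj (TopCat.of X)).ιChainComplex (pathSimplex γ)) 0 (by simp)
      (pathSimplex_isCycle γ) ≫
    HomologicalComplex.homologyπ
      ((TopCat.toSSet.obj (TopCat.of X)).chainComplex (ModuleCat.of ℤ ℤ)) 1).hom (1 : ℤ)

end Homology

/-! ### Voronoi decompositions of the complex plane -/

/-- The closed Voronoi cell of `s` with respect to a set `T` of sites. -/
def cell (T : Set ℂ) (s : ℂ) : Set ℂ := {x | ∀ t ∈ T, ‖x - s‖ ≤ ‖x - t‖}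

/-- The Voronoi vertices: the points that lie in at least three cells. -/
def vertices (T : Set ℂ) : Set ℂ := {x | 2 < {t ∈ T | x ∈ cell T t}.encard}

/-- The bounded part of the Voronoi graph: two distinct vertices `v`, `w` are joined by an edge if
the line segment between them is the common boundary of the cells of two distinct sites. -/
def graph (T : Set ℂ) : SimpleGraph (vertices T) where
  Adj v w := v ≠ w ∧ ∃ s ∈ T, ∃ t ∈ T, s ≠ t ∧ cell T s ∩ cell T t = segment ℝ (v : ℂ) w
  symm := ⟨by
    rintro v w ⟨hne, s, hs, t, ht, hst, h⟩
    exact ⟨hne.symm, s, hs, t, ht, hst, by rw [h, segment_symm]⟩⟩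
  loopless := ⟨fun _ h => h.1 rfl⟩

theorem eq_of_mem_cell {T : Set ℂ} {s u : ℂ} (hu : u ∈ T) (h : u ∈ cell T s) : u = s := by
  have := h u hu
  rw [sub_self, norm_zero] at this
  exact sub_eq_zero.mp (norm_le_zero_iff.mp this)

theorem vertex_notMem {T : Set ℂ} (v : vertices T) : (v : ℂ) ∉ T := by
  intro hv
  have h : {t ∈ T | (v : ℂ) ∈ cell T t}.encard ≤ 1 :=
    Set.encard_le_one_iff.mpr fun a b ha hb =>
      (eq_of_mem_cell hv ha.2).symm.trans (eq_of_mem_cell hv hb.2)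
  exact absurd (lt_of_lt_of_le v.2 h) (by norm_num)

theorem segment_notMem {T : Set ℂ} {v w : vertices T} (h : (graph T).Adj v w) {x : ℂ}
    (hx : x ∈ segment ℝ (v : ℂ) w) : x ∉ T := by
  obtain ⟨-, s, -, t, -, hst, he⟩ := h
  rw [← he] at hx
  exact fun hT => hst ((eq_of_mem_cell hT hx.1).symm.trans (eq_of_mem_cell hT hx.2))

/-! ### The sites: a finite set together with the vertices of a large regular hexagon -/

/-- The centre `c₀`: the average of the points of `S`. -/
def center (S : Finset ℂ) : ℂ := (∑ s ∈ S, s) / (S.card : ℂ)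

/-- The radius `2 * max |s - c₀|`. -/
def radius (S : Finset ℂ) : ℝ := 2 * ((S.sup fun s => ‖s - center S‖₊ : ℝ≥0) : ℝ)

/-- The vertices of the regular hexagon, in the position given by the angle `θ`, inscribed in the
circle with the above centre and radius. -/
def hexagon (S : Finset ℂ) (θ : ℝ) : Set ℂ :=
  Set.range fun k : Fin 6 =>
    center S + (radius S : ℂ) * Complex.exp (((θ + (k : ℕ) * (Real.pi / 3) : ℝ) : ℂ) * Complex.I)

/-- The set `S'` of all sites. -/
def sites (S : Finset ℂ) (θ : ℝ) : Set ℂ := ↑S ∪ hexagon S θ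

/-- The regions `F_s` for `s ∈ S ∪ {∞}`: for `s ∈ S` the Voronoi cell of `s`, and for `s = ∞` the
union of the Voronoi cells of the sites that are not in `S`. -/
def region (S : Finset ℂ) (θ : ℝ) : OnePoint S → Set ℂ
  | OnePoint.infty => ⋃ t ∈ sites S θ \ ↑S, cell (sites S θ) t
  | OnePoint.some s => cell (sites S θ) (s : ℂ)

/-! ### Walks in the Voronoi graph as paths in the complement of `S` -/

/-- The space `ℂ - S`. -/
abbrev Punctured (S : Finset ℂ) : Type := {z : ℂ // z ∉ S}

/-- The Voronoi graph `(V, E)` of `S'`. -/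
abbrev voronoi (S : Finset ℂ) (θ : ℝ) : SimpleGraph (vertices (sites S θ)) := graph (sites S θ)

/-- A Voronoi vertex as a point of `ℂ - S`. -/
def point {S : Finset ℂ} {θ : ℝ} (v : vertices (sites S θ)) : Punctured S :=
  ⟨v, fun h => vertex_notMem v (Or.inl h)⟩

/-- An edge of the Voronoi graph, as the path `t ↦ (1 - t) v + t w` in `ℂ - S`. -/
def edgePath {S : Finset ℂ} {θ : ℝ} {v w : vertices (sites S θ)} (h : (voronoi S θ).Adj v w) :
    Path (point v) (point w) where
  toFun t := ⟨AffineMap.lineMap (v : ℂ) (w : ℂ) (t : ℝ), fun hS =>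
    segment_notMem h (by
      rw [segment_eq_image_lineMap]
      exact ⟨t, t.2, rfl⟩) (Or.inl hS)⟩
  continuous_toFun := by
    refine Continuous.subtype_mk ?_ _
    exact AffineMap.lineMap_continuous.comp continuous_subtype_val
  source' := Subtype.ext (by simp [point])
  target' := Subtype.ext (by simp [point])

/-- A walk in the Voronoi graph, as a path in `ℂ - S`. -/
def walkPath {S : Finset ℂ} {θ : ℝ} {v w : vertices (sites S θ)} :
    (voronoi S θ).Walk v w → Path (point v) (point w)
  | .nil => Path.refl _
  | .cons h p => (edgePath h).trans (walkPath p)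

/-- The cycle `c` of the Voronoi graph traverses the boundary of `A`. -/
def IsBoundaryCycle {S : Finset ℂ} {θ : ℝ} (A : Set ℂ) {v : vertices (sites S θ)}
    (c : (voronoi S θ).Walk v v) : Prop :=
  c.IsCycle ∧ Set.range (fun t : I => (walkPath c t : ℂ)) = frontier A

end VoronoiCycles

end

/-! Every region `F_s` is described radially. The union of the cells of the inner sites of a
`Splitting` (one point `s` of `S`, or all of `S` against the hexagon) is a sublevel set `gauge ≤ 1`
about a base point, where the gauge is a minimum of maxima of linear functionals. It is positively
homogeneous and positive off `0`, the latter because each direction turns from every inner site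
towards some outer site; the hexagon and the factor 2 in the radius ensure this. Hence the boundary
`gauge = 1` meets each ray once and is a continuous image of a circle. Its Voronoi vertices have
exactly one neighbour on either side of their ray, and connectedness of the boundary makes the
resulting 2-regular graph a single cycle.

Fundamental group: cut each region into sectors over its boundary edges. The gauge is affine over an
edge, so sectors are convex; they avoid `S`, there are finitely many, and they are closed off the
base point. Two sectors that meet have edges with a common endpoint. A path in `ℂ - S` is homotopic
to a concatenation of paths inside sectors (`isChain_of_cover`); deforming each passage between
sectors to a common vertex gives a walk (`isWalkClass_of_isChain`). So every class is itself that of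
a walk.

Homology: divide the singular 1-chains modulo boundaries by the span `N` of the cycles. The class of
a path becomes an additive homotopy invariant `q`. If `q` of each path is a difference `g y - g x`
of values at its endpoints, the quotient map factors through the boundary map, so every homology
class lies in `N` (`span_loopClass_eq_top`). To find `g`: as `q` vanishes on the cycle around a
cell, it has a potential on any convex open set with at most one puncture
(`exists_potential_of_cycle`). From a generic point `o` each segment meets at most one point of `S`,
and a thin neighbourhood of it is such a set; `g x` is `q` of a path from `o` to `x` in there
(`exists_potential`). -/

noncomputable section

namespace VoronoiCycles

/-! ### Singular 1-chains modulo boundaries -/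

section Chains

open CategoryTheory Simplicial

variable {X : Type} [TopologicalSpace X]

/-- The singular chain complex with integer coefficients. -/
abbrev chains (X : Type) [TopologicalSpace X] : ChainComplex (ModuleCat.{0} ℤ) ℕ :=
  (TopCat.toSSet.obj (TopCat.of X)).chainComplex (ModuleCat.of ℤ ℤ)

/-- Singular `1`-chains modulo boundaries. -/
abbrev Opcycles (X : Type) [TopologicalSpace X] : ModuleCat.{0} ℤ := (chains X).opcycles 1

/-- The class of a singular `1`-simplex modulo boundaries. -/
def simplexClass (τ : (TopCat.toSSet.obj (TopCat.of X)) _⦋1⦌) : Opcycles X :=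
  ((TopCat.toSSet.obj (TopCat.of X)).ιChainComplex (R := ModuleCat.of ℤ ℤ) τ ≫
    (chains X).pOpcycles 1).hom (1 : ℤ)

/-- The class of a path modulo boundaries. -/
def pathClass {x y : X} (γ : Path x y) : Opcycles X := simplexClass (pathSimplex γ)

/-- The boundary of a singular 2-simplex vanishes modulo boundaries; the negative face is moved to
the right-hand side. -/
theorem simplexClass_faces (τ : (TopCat.toSSet.obj (TopCat.of X)) _⦋2⦌) :
    simplexClass ((TopCat.toSSet.obj (TopCat.of X)).δ 2 τ) +
      simplexClass ((TopCat.toSSet.obj (TopCat.of X)).δ 0 τ) =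
    simplexClass ((TopCat.toSSet.obj (TopCat.of X)).δ 1 τ) := by
  have h := congrArg (fun f => f.hom (1 : ℤ)) (((TopCat.toSSet.obj (TopCat.of X)).ιChainComplex
    (R := ModuleCat.of ℤ ℤ) τ) ≫= (chains X).d_pOpcycles 2 1)
  rw [← Category.assoc, SSet.ιChainComplex_d] at h
  simp only [simplexClass]
  simp at h ⊢
  have h' := (Fin.sum_univ_three _).symm.trans h
  simp only [Fin.val_zero, Fin.val_one, Fin.val_two, pow_zero, pow_one, even_two,
    Even.neg_pow, one_pow, one_smul] at h'
  rw [← sub_eq_zero, ← h']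
  abel

/-- Turns the face relation into one between paths, given a map of the triangle in barycentric
coordinates. Using `extend` spares the proofs that coordinates lie in the unit interval. -/
theorem pathClass_eq_of_triangle {x y z : X} (p : Path x y) (q : Path y z) (r : Path x z)
    (f : C(stdSimplex ℝ (Fin 3), X))
    (hp : ∀ v : stdSimplex ℝ (Fin 3), v 2 = 0 →
      f v = p.extend (v 1))
    (hq : ∀ v : stdSimplex ℝ (Fin 3), v 0 = 0 →
      f v = q.extend (v 2))
    (hr : ∀ v : stdSimplex ℝ (Fin 3), v 1 = 0 →
      f v = r.extend (v 2)) :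
    pathClass p + pathClass q = pathClass r := by
  have h := simplexClass_faces (((TopCat.of X).toSSetObjEquiv (.op ⦋2⦌)).symm f)
  -- The face opposite vertex `i` is where coordinate `i` vanishes; it is parametrised by the
  -- coordinate of its second vertex, `j = i.succAbove 1`.
  have key : ∀ {a b : X} (γ : Path a b) (i : Fin 3) (j : Fin 3) (hj : i.succAbove 1 = j)
    (hf : ∀ v : stdSimplex ℝ (Fin 3), v i = 0 → f v = γ.extend (v j)),
    (TopCat.toSSet.obj (TopCat.of X)).δ i (((TopCat.of X).toSSetObjEquiv (.op ⦋2⦌)).symm f) =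
      pathSimplex γ := by
    intro a b γ i j hj hf
    apply ((TopCat.of X).toSSetObjEquiv (.op ⦋1⦌)).injective
    refine ContinuousMap.ext fun w => ?_
    refine (TopCat.toSSetObjEquiv_δ_apply _ i w).trans ?_
    simp only [pathSimplex, Equiv.apply_symm_apply]
    have h0 : (stdSimplex.map i.succAbove w) i = 0 := by
      rw [stdSimplex.map_coe, FunOnFinite.linearMap_apply_apply]
      exact Finset.sum_eq_zero fun k hk =>
        absurd (Finset.mem_filter.mp hk).2 (Fin.succAbove_ne i k)
    have h1 : (stdSimplex.map i.succAbove w) j = w 1 := by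
      rw [stdSimplex.map_coe, FunOnFinite.linearMap_apply_apply, ← hj]
      rw [Finset.sum_filter, Fin.sum_univ_two]
      simp
    rw [hf _ h0, h1]
    exact Path.extend_apply _ _
  rw [key p 2 1 rfl hp, key q 0 2 rfl hq, key r 1 2 rfl hr] at h
  exact h


/-- The triangle is mapped affinely to the unit interval, vertices going to `0`, `1/2`, `1`, and
then by `p.trans q`. Its sides are `p`, `q` and the concatenation. -/
theorem pathClass_trans {x y z : X} (p : Path x y) (q : Path y z) :
    pathClass (p.trans q) = pathClass p + pathClass q := by
  refine (pathClass_eq_of_triangle p q _ ⟨fun v => (p.trans q).extend (v 1 / 2 + v 2), ?_⟩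
    ?_ ?_ ?_).symm
  · have h1 : Continuous fun v : stdSimplex ℝ (Fin 3) => v 1 :=
      (continuous_apply 1).comp continuous_subtype_val
    have h2 : Continuous fun v : stdSimplex ℝ (Fin 3) => v 2 :=
      (continuous_apply 2).comp continuous_subtype_val
    exact (p.trans q).continuous_extend.comp ((h1.div_const 2).add h2)
  · intro v hv
    have h0 := v.2.1 0
    have h1 := v.2.1 1
    have hs := v.2.2
    rw [Fin.sum_univ_three] at hs
    change v.1 2 = 0 at hv
    change (p.trans q).extend (v.1 1 / 2 + v.1 2) = p.extend (v.1 1)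
    rw [Path.extend_apply _ (by constructor <;> linarith)]
    change (if v.1 1 / 2 + v.1 2 ≤ 1 / 2 then p.extend (2 * (v.1 1 / 2 + v.1 2)) else _) = _
    rw [if_pos (by linarith)]
    congr 1
    linarith
  · intro v hv
    have h1 := v.2.1 1
    have h2 := v.2.1 2
    have hs := v.2.2
    rw [Fin.sum_univ_three] at hs
    change v.1 0 = 0 at hv
    change (p.trans q).extend (v.1 1 / 2 + v.1 2) = q.extend (v.1 2)
    rw [Path.extend_apply _ (by constructor <;> linarith)]
    change (if v.1 1 / 2 + v.1 2 ≤ 1 / 2 then p.extend (2 * (v.1 1 / 2 + v.1 2)) else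
      q.extend (2 * (v.1 1 / 2 + v.1 2) - 1)) = _
    split_ifs with h
    · have e1 : 2 * (v.1 1 / 2 + v.1 2) = 1 := by linarith
      have e2 : v.1 2 = 0 := by linarith
      rw [e1, e2, p.extend_one, q.extend_zero]
    · congr 1
      linarith
  · intro v hv
    change v.1 1 = 0 at hv
    change (p.trans q).extend (v.1 1 / 2 + v.1 2) = (p.trans q).extend (v.1 2)
    rw [hv]
    simp

theorem pathClass_refl (x : X) : pathClass (Path.refl x) = 0 := by
  have h := pathClass_trans (Path.refl x) (Path.refl x)
  rw [Path.refl_trans_refl] at h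
  simpa using h

/-- Cut the square of the homotopy along its diagonal `r`. Each of the two triangles has one
constant side, so both `p` and `q` have the class of `r`. -/
theorem pathClass_homotopic {x y : X} {p q : Path x y} (h : p.Homotopic q) :
    pathClass p = pathClass q := by
  obtain ⟨F⟩ := h
  let E : ℝ × ℝ → X := fun a => F (Set.projIcc 0 1 zero_le_one a.1, Set.projIcc 0 1 zero_le_one a.2)
  have hE : Continuous E := by
    refine F.continuous.comp ?_
    exact (continuous_projIcc.comp continuous_fst).prodMk (continuous_projIcc.comp continuous_snd)
  have E0 (u : ℝ) : E (0, u) = p.extend u := by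
    simp [E, Path.extend, Set.IccExtend]
  have E1 (u : ℝ) : E (1, u) = q.extend u := by
    simp [E, Path.extend, Set.IccExtend]
  have Ex (u : ℝ) : E (u, 0) = x := by simp [E]
  have Ey (u : ℝ) : E (u, 1) = y := by simp [E]
  let r : Path x y :=
    { toFun := fun t => E (t, t)
      continuous_toFun := hE.comp (by fun_prop)
      source' := by simp [Ex]
      target' := by simp [Ey] }
  have hr {u : ℝ} (hu : u ∈ I) : r.extend u = E (u, u) := by
    rw [Path.extend_apply _ hu]; rfl
  have h1 : Continuous fun v : stdSimplex ℝ (Fin 3) => v.1 1 :=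
    (continuous_apply 1).comp continuous_subtype_val
  have h2 : Continuous fun v : stdSimplex ℝ (Fin 3) => v.1 2 :=
    (continuous_apply 2).comp continuous_subtype_val
  have hI (v : stdSimplex ℝ (Fin 3)) : v.1 2 ∈ I :=
    ⟨v.2.1 2, (Finset.single_le_sum (fun i _ => v.2.1 i) (Finset.mem_univ 2)).trans_eq v.2.2⟩
  have hp : pathClass p + pathClass (Path.refl y) = pathClass r := by
    refine pathClass_eq_of_triangle _ _ _ ⟨fun v => E (v.1 2, v.1 1 + v.1 2),
      hE.comp (h2.prodMk (h1.add h2))⟩ ?_ ?_ ?_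
    · intro v hv
      change v.1 2 = 0 at hv
      change E (v.1 2, v.1 1 + v.1 2) = p.extend (v.1 1)
      rw [hv, E0, add_zero]
    · intro v hv
      have hs := v.2.2
      rw [Fin.sum_univ_three] at hs
      change v.1 0 = 0 at hv
      change E (v.1 2, v.1 1 + v.1 2) = _
      rw [show v.1 1 + v.1 2 = 1 by linarith, Ey]
      simp
    · intro v hv
      change v.1 1 = 0 at hv
      change E (v.1 2, v.1 1 + v.1 2) = r.extend (v.1 2)
      rw [hr (hI v), hv, zero_add]
  have hq : pathClass (Path.refl x) + pathClass q = pathClass r := by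
    refine pathClass_eq_of_triangle _ _ _ ⟨fun v => E (v.1 1 + v.1 2, v.1 2),
      hE.comp ((h1.add h2).prodMk h2)⟩ ?_ ?_ ?_
    · intro v hv
      change v.1 2 = 0 at hv
      change E (v.1 1 + v.1 2, v.1 2) = _
      rw [hv, Ex]
      simp
    · intro v hv
      have hs := v.2.2
      rw [Fin.sum_univ_three] at hs
      change v.1 0 = 0 at hv
      change E (v.1 1 + v.1 2, v.1 2) = q.extend (v.1 2)
      rw [show v.1 1 + v.1 2 = 1 by linarith, E1]
    · intro v hv
      change v.1 1 = 0 at hv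
      change E (v.1 1 + v.1 2, v.1 2) = r.extend (v.1 2)
      rw [hr (hI v), hv, zero_add]
  rw [pathClass_refl, add_zero] at hp
  rw [pathClass_refl, zero_add] at hq
  rw [hp, hq]

theorem homologyι_loopClass {x : X} (γ : Path x x) :
    ((chains X).homologyι 1).hom (loopClass γ) = pathClass γ := by
  rw [loopClass, ← ModuleCat.comp_apply, Category.assoc, HomologicalComplex.homology_π_ι,
    HomologicalComplex.liftCycles_i_assoc]
  rfl

theorem exists_path_of_simplex (τ : (TopCat.toSSet.obj (TopCat.of X)) _⦋1⦌) :
    ∃ γ : Path (TopCat.toSSetObj₀Equiv ((TopCat.toSSet.obj (TopCat.of X)).δ 1 τ) : X)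
      (TopCat.toSSetObj₀Equiv ((TopCat.toSSet.obj (TopCat.of X)).δ 0 τ) : X),
      pathSimplex γ = τ := by
  let f := (TopCat.of X).toSSetObjEquiv (.op ⦋1⦌) τ
  refine ⟨⟨f.comp ⟨stdSimplexHomeomorphUnitInterval.symm,
    stdSimplexHomeomorphUnitInterval.symm.continuous⟩, ?_, ?_⟩, ?_⟩
  · refine congrArg f (a₂ := stdSimplex.map (Fin.succAbove 1) (default : stdSimplex ℝ (Fin 1))) ?_
    rw [show (default : stdSimplex ℝ (Fin 1)) = stdSimplex.vertex 0 from Subsingleton.elim _ _,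
      stdSimplex.map_vertex]
    exact stdSimplexHomeomorphUnitInterval.symm_apply_eq.mpr
      stdSimplexHomeomorphUnitInterval_zero.symm
  · refine congrArg f (a₂ := stdSimplex.map (Fin.succAbove 0) (default : stdSimplex ℝ (Fin 1))) ?_
    rw [show (default : stdSimplex ℝ (Fin 1)) = stdSimplex.vertex 0 from Subsingleton.elim _ _,
      stdSimplex.map_vertex]
    exact stdSimplexHomeomorphUnitInterval.symm_apply_eq.mpr
      stdSimplexHomeomorphUnitInterval_one.symm
  · apply ((TopCat.of X).toSSetObjEquiv (.op ⦋1⦌)).injective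
    refine ContinuousMap.ext fun w => ?_
    simp only [pathSimplex, Equiv.apply_symm_apply]
    exact congrArg f (stdSimplexHomeomorphUnitInterval.symm_apply_apply w)

/-- Extend `g` linearly to 0-chains. Then `π` is the boundary map on opcycles followed by this
extension, so it kills homology, which embeds in the opcycles as the kernel of the boundary. Thus
homology lies in the span of the given classes, and injectivity of `homologyι` lifts this back. -/
theorem span_loopClass_eq_top {ι : Type} {x : ι → X} (γ : ∀ i, Path (x i) (x i))
    {A : Type} [AddCommGroup A] [hA : Module ℤ A] (π : Opcycles X →ₗ[ℤ] A)
    (hπ : LinearMap.ker π ≤ Submodule.span ℤ (Set.range fun i => pathClass (γ i)))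
    (g : X → A) (hg : ∀ (y z : X) (δ : Path y z), π (pathClass δ) = g z - g y) :
    Submodule.span ℤ (Set.range fun i => loopClass (γ i)) = (⊤ : Submodule ℤ (H1 X)) := by
  let Φ : (chains X).X 0 ⟶ ModuleCat.of ℤ A :=
    ((TopCat.toSSet.obj (TopCat.of X)).isColimitChainComplexXCofan (ModuleCat.of ℤ ℤ) 0).desc
      (Limits.Cofan.mk _ fun a => ModuleCat.ofHom
        (LinearMap.toSpanSingleton ℤ _ (g (TopCat.toSSetObj₀Equiv a))))
  have hΦ (a : (TopCat.toSSet.obj (TopCat.of X)) _⦋0⦌) :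
      (TopCat.toSSet.obj (TopCat.of X)).ιChainComplex a ≫ Φ = ModuleCat.ofHom
        (LinearMap.toSpanSingleton ℤ _ (g (TopCat.toSSetObj₀Equiv a))) :=
    ((TopCat.toSSet.obj (TopCat.of X)).isColimitChainComplexXCofan (ModuleCat.of ℤ ℤ) 0).fac _ ⟨a⟩
  -- It suffices to compare on one 1-simplex, that is on one path: its boundary is endpoint minus
  -- starting point.
  have h1 : (chains X).fromOpcycles 1 0 ≫ Φ = ModuleCat.ofHom π := by
    rw [← cancel_epi ((chains X).pOpcycles 1), HomologicalComplex.p_fromOpcycles_assoc]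
    refine SSet.chainComplex_hom_ext fun τ => ?_
    obtain ⟨δ, hδ⟩ := exists_path_of_simplex τ
    have hd : (TopCat.toSSet.obj (TopCat.of X)).ιChainComplex (R := ModuleCat.of ℤ ℤ) τ ≫
        (chains X).d 1 0 = (TopCat.toSSet.obj (TopCat.of X)).ιChainComplex
          ((TopCat.toSSet.obj (TopCat.of X)).δ 0 τ) - (TopCat.toSSet.obj (TopCat.of X)).ιChainComplex
          ((TopCat.toSSet.obj (TopCat.of X)).δ 1 τ) := by
      refine (SSet.ιChainComplex_d _ _ τ).trans ((Fin.sum_univ_two _).trans ?_)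
      simp [sub_eq_add_neg]
    rw [← Category.assoc, hd, Preadditive.sub_comp, hΦ, hΦ]
    apply ModuleCat.hom_ext
    refine LinearMap.ext_ring ?_
    have h := hg _ _ δ
    rw [pathClass, hδ] at h
    exact (congrArg₂ (· - ·) (@one_smul ℤ A _ hA.toMulAction _) (@one_smul ℤ A _ hA.toMulAction _)).trans h.symm
  refine eq_top_iff.mpr fun z _ => ?_
  have hz : ((chains X).homologyι 1).hom z ∈ LinearMap.ker π := by
    have hc : (chains X).homologyι 1 ≫ ModuleCat.ofHom π = 0 := by
      refine (congrArg ((chains X).homologyι 1 ≫ ·) h1.symm).trans ?_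
      rw [← Category.assoc, HomologicalComplex.homologyι_comp_fromOpcycles, Limits.zero_comp]
    exact congrArg (fun f => f.hom z) hc
  have hspan (n : Opcycles X)
      (hn : n ∈ Submodule.span ℤ (Set.range fun i => pathClass (γ i))) :
      ∃ w ∈ Submodule.span ℤ (Set.range fun i => loopClass (γ i)),
        ((chains X).homologyι 1).hom w = n := by
    induction hn using Submodule.span_induction with
    | mem n h =>
      obtain ⟨i, rfl⟩ := h
      exact ⟨_, Submodule.subset_span ⟨i, rfl⟩, homologyι_loopClass (γ i)⟩
    | zero => exact ⟨0, Submodule.zero_mem _, map_zero _⟩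
    | add a b _ _ ha hb =>
      obtain ⟨u, hu, rfl⟩ := ha
      obtain ⟨v, hv, rfl⟩ := hb
      exact ⟨u + v, Submodule.add_mem _ hu hv, map_add _ _ _⟩
    | smul k a _ ha =>
      obtain ⟨u, hu, rfl⟩ := ha
      exact ⟨_, Submodule.smul_mem _ k hu, LinearMap.map_smul ((chains X).homologyι 1).hom k u⟩
  obtain ⟨w, hw, hwz⟩ := hspan _ (hπ hz)
  have hinj : Function.Injective ((chains X).homologyι 1).hom :=
    (ModuleCat.mono_iff_injective _).mp inferInstance
  rwa [← hinj hwz]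

end Chains

/-! ### Local-to-global principles for paths -/

section LocalGlobal

open Topology

/-- Both implications near each point make `D` locally constant, and the interval is connected. -/
theorem unitInterval_induction (D : I → Prop) (h0 : D 0)
    (h : ∀ t, ∀ᶠ u in 𝓝 t, (D t → D u) ∧ (D u → D t)) : D 1 := by
  have hc : IsLocallyConstant D := by
    rw [IsLocallyConstant.iff_eventually_eq]
    exact fun t => (h t).mono fun u hu => propext ⟨hu.2, hu.1⟩
  exact (hc.apply_eq_of_isPreconnected isPreconnected_univ (Set.mem_univ 1)
    (Set.mem_univ 0)).mpr h0

/-- The property is propagated along the initial subpaths from `0` to `t`. The step is needed in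
both directions, since a nearby parameter may transfer the property to or from `t`. -/
theorem path_induction {X : Type} [TopologicalSpace X]
    (D : ∀ x y : X, Path x y → Prop) (Y : Set X)
    (refl : ∀ x, D x x (Path.refl x))
    (congr : ∀ {x y : X} {p q : Path x y}, p.Homotopic q → D x y p → D x y q)
    (step : ∀ x ∈ Y, ∃ U ∈ 𝓝 x, ∀ y ∈ U ∩ Y, ∀ a : X,
      (∀ (p : Path a x) (δ : Path x y), (∀ t, δ t ∈ U ∩ Y) → D a x p → D a y (p.trans δ)) ∧
      (∀ (p : Path a y) (δ : Path y x), (∀ t, δ t ∈ U ∩ Y) → D a y p → D a x (p.trans δ)))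
    {a b : X} (γ : Path a b) (hγ : ∀ t, γ t ∈ Y) : D a b γ := by
  have key : D _ _ (γ.subpath 0 1) := by
    refine unitInterval_induction (fun t => D _ _ (γ.subpath 0 t)) ?_ fun t => ?_
    · rw [Path.subpath_self]
      exact refl _
    · obtain ⟨U, hU, hs⟩ := step (γ t) (hγ t)
      have hU' : γ ⁻¹' U ∈ 𝓝 t := γ.continuous.continuousAt hU
      obtain ⟨ε, hε, hball⟩ := Metric.mem_nhds_iff.mp hU'
      filter_upwards [Metric.ball_mem_nhds t hε] with u hu
      have hsub : ∀ w ∈ Set.uIcc t u, γ w ∈ U ∩ Y := fun w hw => by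
        refine ⟨hball ?_, hγ w⟩
        rw [Metric.mem_ball] at hu ⊢
        refine lt_of_le_of_lt ?_ hu
        rw [Subtype.dist_eq, Subtype.dist_eq, Real.dist_eq, Real.dist_eq]
        rw [abs_sub_comm _ (t : ℝ), abs_sub_comm _ (t : ℝ)]
        rcases le_total t u with h | h
        · rw [Set.uIcc_of_le h] at hw
          have h1 : (t : ℝ) ≤ w := hw.1
          have h2 : (w : ℝ) ≤ u := hw.2
          rw [abs_of_nonpos (by linarith), abs_of_nonpos (by linarith)]
          linarith
        · rw [Set.uIcc_of_ge h] at hw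
          have h1 : (u : ℝ) ≤ w := hw.1
          have h2 : (w : ℝ) ≤ t := hw.2
          rw [abs_of_nonneg (by linarith), abs_of_nonneg (by linarith)]
          linarith
      have hrange : ∀ s, γ.subpath t u s ∈ U ∩ Y := fun s => by
        have : γ.subpath t u s ∈ Set.range (γ.subpath t u) := ⟨s, rfl⟩
        rw [Path.range_subpath] at this
        obtain ⟨w, hw, h⟩ := this
        exact h ▸ hsub w hw
      have hrange' : ∀ s, γ.subpath u t s ∈ U ∩ Y := fun s => by
        have : γ.subpath u t s ∈ Set.range (γ.subpath u t) := ⟨s, rfl⟩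
        rw [Path.range_subpath, Set.uIcc_comm] at this
        obtain ⟨w, hw, h⟩ := this
        exact h ▸ hsub w hw
      have hu' := hs (γ u) (hsub u Set.right_mem_uIcc) (γ 0)
      exact ⟨fun h => congr ⟨Path.Homotopy.subpathTransSubpath γ 0 t u⟩ (hu'.1 _ _ hrange h),
        fun h => congr ⟨Path.Homotopy.subpathTransSubpath γ 0 u t⟩ (hu'.2 _ _ hrange' h)⟩
  rw [Path.subpath_zero_one] at key
  have hcast : ∀ {a' b' : X} (ha : a' = a) (hb : b' = b), D a' b' (γ.cast ha hb) → D a b γ := by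
    rintro a' b' rfl rfl h
    exact h
  exact hcast _ _ key

/-- An additive, homotopy invariant function on paths. -/
structure PathInvariant (X A : Type) [TopologicalSpace X] [AddCommGroup A] where
  /-- The value on a path. -/
  val : ∀ {x y : X}, Path x y → A
  homotopic : ∀ {x y : X} {p q : Path x y}, p.Homotopic q → val p = val q
  trans : ∀ {x y z : X} (p : Path x y) (q : Path y z), val (p.trans q) = val p + val q

namespace PathInvariant

variable {X A : Type} [TopologicalSpace X] [AddCommGroup A] (q : PathInvariant X A)

theorem refl (x : X) : q.val (Path.refl x) = 0 := by
  have h := q.trans (Path.refl x) (Path.refl x)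
  rw [Path.refl_trans_refl] at h
  simpa using h

theorem symm {x y : X} (p : Path x y) : q.val p.symm = -q.val p := by
  have h := q.homotopic (⟨Path.Homotopy.reflTransSymm p⟩ :
    (Path.refl x).Homotopic (p.trans p.symm))
  rw [q.refl, q.trans] at h
  exact (neg_eq_of_add_eq_zero_right h.symm).symm

/-- A local potential is a global one by additivity. The local hypothesis only concerns paths that
start at `x`; paths towards `x` are reversed. -/
theorem eq_sub_of_local (Y : Set X) (g : X → A)
    (hg : ∀ x ∈ Y, ∃ U ∈ 𝓝 x, ∀ y ∈ U, ∀ δ : Path x y, (∀ t, δ t ∈ U) →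
      q.val δ = g y - g x) {x y : X} (γ : Path x y) (hγ : ∀ t, γ t ∈ Y) :
    q.val γ = g y - g x := by
  refine path_induction (fun x y p => q.val p = g y - g x) Y ?_ ?_ ?_ γ hγ
  · intro x
    simp [q.refl]
  · intro x y p p' h hp
    rw [← q.homotopic h, hp]
  · intro x hx
    obtain ⟨U, hU, h⟩ := hg x hx
    refine ⟨U, hU, fun y hy a => ⟨fun p δ hδ hp => ?_, fun p δ hδ hp => ?_⟩⟩
    · rw [q.trans, hp, h y hy.1 δ fun t => (hδ t).1]
      abel
    · have := h y hy.1 δ.symm fun t => (hδ _).1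
      rw [q.symm] at this
      rw [q.trans, hp, ← neg_neg (q.val δ), this]
      abel

end PathInvariant

variable {S : Finset ℂ}

/-- Two paths in a convex set that avoids `S` are homotopic in the complement of `S`. -/
theorem homotopic_of_convex {C : Set ℂ} (hC : Convex ℝ C) (hCS : ∀ z ∈ C, z ∉ S)
    {x y : Punctured S} (p q : Path x y) (hp : ∀ t, (p t : ℂ) ∈ C) (hq : ∀ t, (q t : ℂ) ∈ C) :
    p.Homotopic q :=
  ⟨{ toFun := fun a => ⟨AffineMap.lineMap (p a.2 : ℂ) (q a.2 : ℂ) (a.1 : ℝ),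
        hCS _ (hC.lineMap_mem (hp _) (hq _) a.1.2)⟩
     continuous_toFun := by
        refine Continuous.subtype_mk ?_ _
        simp only [AffineMap.lineMap_apply]
        have h1 : Continuous fun a : I × I => (p a.2 : ℂ) :=
          continuous_subtype_val.comp (p.continuous.comp continuous_snd)
        have h2 : Continuous fun a : I × I => (q a.2 : ℂ) :=
          continuous_subtype_val.comp (q.continuous.comp continuous_snd)
        have h3 : Continuous fun a : I × I => (a.1 : ℝ) :=
          continuous_subtype_val.comp continuous_fst
        exact (h3.smul (h2.sub h1)).add h1
     map_zero_left := fun t => Subtype.ext (by simp)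
     map_one_left := fun t => Subtype.ext (by simp)
     prop' := by
        rintro t s (rfl | rfl) <;> exact Subtype.ext (by simp) }⟩

/-- The straight path between two points of a convex set that avoids `S`. -/
def segmentPath (x y : Punctured S) (h : ∀ z ∈ segment ℝ (x : ℂ) y, z ∉ S) : Path x y where
  toFun t := ⟨AffineMap.lineMap (x : ℂ) (y : ℂ) (t : ℝ), h _ (by
    rw [segment_eq_image_lineMap]; exact ⟨t, t.2, rfl⟩)⟩
  continuous_toFun := by
    refine Continuous.subtype_mk ?_ _
    exact AffineMap.lineMap_continuous.comp continuous_subtype_val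
  source' := Subtype.ext (by simp)
  target' := Subtype.ext (by simp)

theorem segmentPath_mem (x y : Punctured S) (h : ∀ z ∈ segment ℝ (x : ℂ) y, z ∉ S) (t : I) :
    (segmentPath x y h t : ℂ) ∈ segment ℝ (x : ℂ) y := by
  rw [segment_eq_image_lineMap]
  exact ⟨t, t.2, rfl⟩

theorem exists_path_of_convex {C : Set ℂ} (hC : Convex ℝ C) (hCS : ∀ z ∈ C, z ∉ S)
    {x y : Punctured S} (hx : (x : ℂ) ∈ C) (hy : (y : ℂ) ∈ C) :
    ∃ p : Path x y, ∀ t, (p t : ℂ) ∈ C :=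
  ⟨segmentPath x y fun z hz => hCS z (hC.segment_subset hx hy hz), fun t =>
    hC.segment_subset hx hy (segmentPath_mem x y _ t)⟩

theorem trans_mem {C : Set ℂ} {x y z : Punctured S} {p : Path x y} {q : Path y z}
    (hp : ∀ t, (p t : ℂ) ∈ C) (hq : ∀ t, (q t : ℂ) ∈ C) (t : I) : (p.trans q t : ℂ) ∈ C := by
  rw [Path.trans_apply]
  split_ifs
  exacts [hp _, hq _]

/-- Paths that are homotopic to concatenations of paths inside members of a family of sets. -/
inductive IsChain (P : Set (Set ℂ)) : ∀ {x y : Punctured S}, Path x y → Prop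
  | refl (x : Punctured S) : IsChain P (Path.refl x)
  | snoc {x y z : Punctured S} {p : Path x y} (hp : IsChain P p) (δ : Path y z) {C : Set ℂ}
      (hC : C ∈ P) (hδ : ∀ t, (δ t : ℂ) ∈ C) : IsChain P (p.trans δ)
  | congr {x y : Punctured S} {p q : Path x y} (h : p.Homotopic q) (hp : IsChain P p) :
      IsChain P q

/-- The members need not be open. A short path between `x` and `y` is homotopic, within a ball that
avoids `S`, to the segment, and the segment lies in the member that contains both ends. -/
theorem isChain_of_cover {P : Set (Set ℂ)} (hP : ∀ C ∈ P, Convex ℝ C ∧ ∀ z ∈ C, z ∉ S)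
    (hloc : ∀ x : Punctured S, ∃ r > 0, (∀ z ∈ Metric.ball (x : ℂ) r, z ∉ S) ∧
      ∀ y ∈ Metric.ball (x : ℂ) r, ∃ C ∈ P, (x : ℂ) ∈ C ∧ y ∈ C)
    {x y : Punctured S} (γ : Path x y) : IsChain P γ := by
  refine path_induction (fun _ _ p => IsChain P p) Set.univ IsChain.refl IsChain.congr ?_ γ
    fun _ => Set.mem_univ _
  intro x _
  obtain ⟨r, hr, hrS, hrP⟩ := hloc x
  refine ⟨Subtype.val ⁻¹' Metric.ball (x : ℂ) r,
    continuous_subtype_val.continuousAt (Metric.ball_mem_nhds _ hr), fun y hy a => ?_⟩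
  obtain ⟨C, hC, hxC, hyC⟩ := hrP y hy.1
  have hxB : (x : ℂ) ∈ Metric.ball (x : ℂ) r := Metric.mem_ball_self hr
  refine ⟨fun p δ hδ hp => ?_, fun p δ hδ hp => ?_⟩
  · have hs := (hP C hC).1.segment_subset hxC hyC
    have hb := (convex_ball (x : ℂ) r).segment_subset hxB hy.1
    let ε := segmentPath x y fun z hz => hrS z (hb hz)
    exact IsChain.congr (Path.Homotopic.hcomp (Path.Homotopic.refl p)
      (homotopic_of_convex (convex_ball _ _) hrS ε δ (fun t => hb (segmentPath_mem _ _ _ t))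
        fun t => (hδ t).1)) (hp.snoc ε hC fun t => hs (segmentPath_mem _ _ _ t))
  · have hs := (hP C hC).1.segment_subset hyC hxC
    have hb := (convex_ball (x : ℂ) r).segment_subset hy.1 hxB
    let ε := segmentPath y x fun z hz => hrS z (hb hz)
    exact IsChain.congr (Path.Homotopic.hcomp (Path.Homotopic.refl p)
      (homotopic_of_convex (convex_ball _ _) hrS ε δ (fun t => hb (segmentPath_mem _ _ _ t))
        fun t => (hδ t).1)) (hp.snoc ε hC fun t => hs (segmentPath_mem _ _ _ t))

end LocalGlobal

/-! ### Planar Voronoi diagrams -/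

section Voronoi

open Topology

/-- The real inner product of two complex numbers. -/
def dot (z w : ℂ) : ℝ := z.re * w.re + z.im * w.im

/-- The determinant of two complex numbers. -/
def cross (z w : ℂ) : ℝ := z.re * w.im - z.im * w.re

/-- After squaring, the quadratic terms in `x` cancel. The origin `a` is free, so that it can later
be the base point of a splitting. -/
theorem norm_sub_le_iff (a x s t : ℂ) : ‖x - s‖ ≤ ‖x - t‖ ↔
    2 * dot (x - a) (t - s) ≤ Complex.normSq (t - a) - Complex.normSq (s - a) := by
  rw [← sq_le_sq₀ (norm_nonneg _) (norm_nonneg _), ← Complex.normSq_eq_norm_sq,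
    ← Complex.normSq_eq_norm_sq]
  simp only [Complex.normSq_apply, dot, Complex.sub_re, Complex.sub_im]
  constructor <;> intro h <;> nlinarith

theorem norm_sub_eq_iff (a x s t : ℂ) : ‖x - s‖ = ‖x - t‖ ↔
    2 * dot (x - a) (t - s) = Complex.normSq (t - a) - Complex.normSq (s - a) := by
  rw [le_antisymm_iff, norm_sub_le_iff a, norm_sub_le_iff a, le_antisymm_iff]
  have : dot (x - a) (s - t) = - dot (x - a) (t - s) := by
    simp only [dot, Complex.sub_re, Complex.sub_im]; ring
  rw [this]
  constructor <;> rintro ⟨h1, h2⟩ <;> constructor <;> linarith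

/-- Uniqueness of the circumcentre. If `v ≠ w`, both `t - s` and `u - s` are orthogonal to `v - w`,
so `u - s = l (t - s)`; equal distances then force `l = 0` or `l = 1`, that is `u = s` or `u = t`.
-/
theorem eq_of_equidistant {s t u v w : ℂ} (hst : s ≠ t) (hsu : s ≠ u) (htu : t ≠ u)
    (h1 : ‖v - s‖ = ‖v - t‖) (h2 : ‖v - s‖ = ‖v - u‖) (h3 : ‖w - s‖ = ‖w - t‖)
    (h4 : ‖w - s‖ = ‖w - u‖) : v = w := by
  rw [norm_sub_eq_iff s] at h1 h2 h3 h4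
  simp only [dot, Complex.normSq_apply, Complex.sub_re, Complex.sub_im, sub_self,
    Complex.zero_re, Complex.zero_im] at h1 h2 h3 h4
  by_contra hvw
  have hd : v.re - w.re ≠ 0 ∨ v.im - w.im ≠ 0 := by
    by_contra! h
    exact hvw (Complex.ext (sub_eq_zero.mp h.1) (sub_eq_zero.mp h.2))
  obtain ⟨p1, hp1⟩ : ∃ a, a = t.re - s.re := ⟨_, rfl⟩
  obtain ⟨p2, hp2⟩ : ∃ a, a = t.im - s.im := ⟨_, rfl⟩
  obtain ⟨q1, hq1⟩ : ∃ a, a = u.re - s.re := ⟨_, rfl⟩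
  obtain ⟨q2, hq2⟩ : ∃ a, a = u.im - s.im := ⟨_, rfl⟩
  obtain ⟨c1, hc1⟩ : ∃ a, a = v.re - s.re := ⟨_, rfl⟩
  obtain ⟨c2, hc2⟩ : ∃ a, a = v.im - s.im := ⟨_, rfl⟩
  obtain ⟨d1, hd1⟩ : ∃ a, a = v.re - w.re := ⟨_, rfl⟩
  obtain ⟨d2, hd2⟩ : ∃ a, a = v.im - w.im := ⟨_, rfl⟩
  rw [← hd1, ← hd2] at hd
  rw [← hp1, ← hp2, ← hc1, ← hc2] at h1
  rw [← hq1, ← hq2, ← hc1, ← hc2] at h2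
  rw [← hp1, ← hp2, show w.re - s.re = c1 - d1 by linarith,
    show w.im - s.im = c2 - d2 by linarith] at h3
  rw [← hq1, ← hq2, show w.re - s.re = c1 - d1 by linarith,
    show w.im - s.im = c2 - d2 by linarith] at h4
  have e1 : d1 * p1 + d2 * p2 = 0 := by linarith
  have e2 : d1 * q1 + d2 * q2 = 0 := by linarith
  have hcr : p1 * q2 - p2 * q1 = 0 := by
    rcases hd with h | h
    · refine (mul_eq_zero.mp (?_ : d1 * _ = 0)).resolve_left h
      linear_combination q2 * e1 - p2 * e2
    · refine (mul_eq_zero.mp (?_ : d2 * _ = 0)).resolve_left h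
      linear_combination p1 * e2 - q1 * e1
  have hp : p1 * p1 + p2 * p2 ≠ 0 := by
    intro h
    have : p1 = 0 := by nlinarith [sq_nonneg p1, sq_nonneg p2]
    have : p2 = 0 := by nlinarith [sq_nonneg p1, sq_nonneg p2]
    exact hst (Complex.ext (by linarith) (by linarith))
  obtain ⟨l, hl⟩ : ∃ l, l = (p1 * q1 + p2 * q2) / (p1 * p1 + p2 * p2) := ⟨_, rfl⟩
  have hl' : l * (p1 * p1 + p2 * p2) = p1 * q1 + p2 * q2 := by rw [hl, div_mul_cancel₀ _ hp]
  have hq1' : q1 = l * p1 := by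
    refine mul_right_cancel₀ hp ?_
    linear_combination -p1 * hl' - p2 * hcr
  have hq2' : q2 = l * p2 := by
    refine mul_right_cancel₀ hp ?_
    linear_combination -p2 * hl' + p1 * hcr
  have hll : l * (l - 1) = 0 := by
    refine mul_right_cancel₀ hp ?_
    rw [hq1', hq2'] at h2
    linear_combination l * h1 - h2
  rcases mul_eq_zero.mp hll with h | h
  · rw [h, zero_mul] at hq1' hq2'
    exact hsu (Complex.ext (by linarith) (by linarith))
  · rw [sub_eq_zero.mp h, one_mul] at hq1' hq2'
    exact htu (Complex.ext (by linarith) (by linarith))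

variable {T : Set ℂ}

theorem isClosed_cell (T : Set ℂ) (s : ℂ) : IsClosed (cell T s) := by
  have : cell T s = ⋂ t ∈ T, {x | ‖x - s‖ ≤ ‖x - t‖} := by
    ext x; simp [cell]
  rw [this]
  exact isClosed_biInter fun t _ => isClosed_le (by fun_prop) (by fun_prop)

theorem convex_cell (T : Set ℂ) (s : ℂ) : Convex ℝ (cell T s) := by
  intro x hx y hy a b ha hb hab t ht
  have h1 := hx t ht
  have h2 := hy t ht
  rw [norm_sub_le_iff 0] at h1 h2 ⊢
  have : dot (a • x + b • y - 0) (t - s) = a * dot (x - 0) (t - s) + b * dot (y - 0) (t - s) := by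
    simp [dot]; ring
  rw [this]
  obtain rfl : b = 1 - a := by linarith
  nlinarith [mul_le_mul_of_nonneg_left h1 ha, mul_le_mul_of_nonneg_left h2 hb]

theorem norm_eq_of_mem_cells {s t x : ℂ} (hs : s ∈ T) (ht : t ∈ T) (hxs : x ∈ cell T s)
    (hxt : x ∈ cell T t) : ‖x - s‖ = ‖x - t‖ :=
  le_antisymm (hxs t ht) (hxt s hs)

theorem mem_cell_of_le {s t x : ℂ} (h : x ∈ cell T s) (hts : ‖x - t‖ ≤ ‖x - s‖) :
    x ∈ cell T t := fun u hu => hts.trans (h u hu)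

theorem exists_third_cell {x : ℂ} (hx : x ∈ vertices T) (s t : ℂ) :
    ∃ u ∈ T, u ≠ s ∧ u ≠ t ∧ x ∈ cell T u := by
  by_contra! h
  have hsub : {t ∈ T | x ∈ cell T t} ⊆ {s, t} := by
    rintro u ⟨hu, hxu⟩
    by_contra hn
    simp only [Set.mem_insert_iff, Set.mem_singleton_iff, not_or] at hn
    exact h u hu hn.1 hn.2 hxu
  have h2 : ({s, t} : Set ℂ).encard ≤ 2 :=
    (Set.encard_insert_le _ _).trans (by rw [Set.encard_singleton]; norm_num)
  exact absurd (lt_of_lt_of_le hx ((Set.encard_le_encard hsub).trans h2)) (lt_irrefl _)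

theorem mem_vertices {s t u x : ℂ} (hs : s ∈ T) (ht : t ∈ T) (hu : u ∈ T) (hst : s ≠ t)
    (hus : u ≠ s) (hut : u ≠ t) (hxs : x ∈ cell T s) (hxt : x ∈ cell T t) (hxu : x ∈ cell T u) :
    x ∈ vertices T := by
  have h3 : ({u, s, t} : Set ℂ).encard = 3 := Set.encard_eq_three.mpr ⟨u, s, t, hus, hut, hst, rfl⟩
  have hsub : ({u, s, t} : Set ℂ) ⊆ {t ∈ T | x ∈ cell T t} := by
    rintro a (rfl | rfl | rfl)
    exacts [⟨hu, hxu⟩, ⟨hs, hxs⟩, ⟨ht, hxt⟩]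
  refine lt_of_lt_of_le ?_ (Set.encard_le_encard hsub)
  rw [h3]
  norm_num

theorem finite_vertices (hT : T.Finite) : (vertices T).Finite := by
  let E : ℂ × ℂ × ℂ → Set ℂ := fun a => {x | a.1 ≠ a.2.1 ∧ a.1 ≠ a.2.2 ∧ a.2.1 ≠ a.2.2 ∧
    ‖x - a.1‖ = ‖x - a.2.1‖ ∧ ‖x - a.1‖ = ‖x - a.2.2‖}
  have hE : ∀ a, (E a).Finite := fun a => Set.Subsingleton.finite
    fun x hx y hy => eq_of_equidistant hx.1 hx.2.1 hx.2.2.1 hx.2.2.2.1 hx.2.2.2.2 hy.2.2.2.1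
      hy.2.2.2.2
  refine ((hT.prod (hT.prod hT)).biUnion fun a _ => hE a).subset fun x hx => ?_
  obtain ⟨s, hs, -, -, hxs⟩ := exists_third_cell hx 0 0
  obtain ⟨t, ht, hts, -, hxt⟩ := exists_third_cell hx s s
  obtain ⟨u, hu, hus, hut, hxu⟩ := exists_third_cell hx s t
  exact Set.mem_biUnion (x := (s, t, u)) ⟨hs, ht, hu⟩ ⟨hts.symm, hus.symm, hut.symm,
    norm_eq_of_mem_cells hs ht hxs hxt, norm_eq_of_mem_cells hs hu hxs hxu⟩

/-- For a third site `u` the difference of the squared distances to `u` and `s` is affine,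
nonnegative at both ends of the edge and zero at `x`. If `x` were interior it would vanish at both
ends, which would then be circumcentres of the same three sites and hence equal. -/
theorem eq_endpoint_of_mem_vertices {s t v w x : ℂ} (hs : s ∈ T) (ht : t ∈ T) (hst : s ≠ t)
    (he : cell T s ∩ cell T t = segment ℝ v w) (hx : x ∈ vertices T)
    (hxe : x ∈ segment ℝ v w) : x = v ∨ x = w := by
  obtain ⟨u, hu, hus, hut, hxu⟩ := exists_third_cell hx s t
  by_contra! hne
  have hv : v ∈ cell T s ∩ cell T t := he ▸ left_mem_segment ℝ v w
  have hw : w ∈ cell T s ∩ cell T t := he ▸ right_mem_segment ℝ v w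
  have hx' : x ∈ cell T s ∩ cell T t := he ▸ hxe
  have hxo : x ∈ openSegment ℝ v w := mem_openSegment_of_ne_left_right hne.1.symm hne.2.symm hxe
  obtain ⟨a, b, ha, hb, hab, rfl⟩ := hxo
  have h0 := norm_eq_of_mem_cells hs hu hx'.1 hxu
  have h1 := hv.1 u hu
  have h2 := hw.1 u hu
  have key : ∀ y : ℂ, dot (y - 0) (u - s) = dot y (u - s) := fun y => by rw [sub_zero]
  have hlin : dot (a • v + b • w) (u - s) = a * dot v (u - s) + b * dot w (u - s) := by
    simp [dot]; ring
  rw [norm_sub_eq_iff 0, key, hlin] at h0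
  rw [norm_sub_le_iff 0, key] at h1 h2
  obtain rfl : b = 1 - a := by linarith
  have e1 : ‖v - s‖ = ‖v - u‖ := by
    rw [norm_sub_eq_iff 0, key]
    refine le_antisymm h1 ?_
    nlinarith
  have e2 : ‖w - s‖ = ‖w - u‖ := by
    rw [norm_sub_eq_iff 0, key]
    refine le_antisymm h2 ?_
    nlinarith
  have hvw := eq_of_equidistant hst hus.symm hut.symm (norm_eq_of_mem_cells hs ht hv.1 hv.2) e1
    (norm_eq_of_mem_cells hs ht hw.1 hw.2) e2
  subst hvw
  rw [segment_same] at hxe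
  exact hne.1 hxe

/-- The direction `I * (t - s)` runs along the bisector. At a point that is not a vertex all other
sites are strictly farther away, and this persists nearby. -/
theorem eventually_mem_cells (hT : T.Finite) {s t x : ℂ} (hs : s ∈ T) (ht : t ∈ T) (hst : s ≠ t)
    (hxs : x ∈ cell T s) (hxt : x ∈ cell T t) (hx : x ∉ vertices T) :
    ∀ᶠ r : ℝ in 𝓝 0, x + (r : ℂ) * (Complex.I * (t - s)) ∈ cell T s ∩ cell T t := by
  have hc : Continuous fun r : ℝ => x + (r : ℂ) * (Complex.I * (t - s)) := by fun_prop
  have heq : ∀ r : ℝ, ‖x + (r : ℂ) * (Complex.I * (t - s)) - s‖ =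
      ‖x + (r : ℂ) * (Complex.I * (t - s)) - t‖ := fun r => by
    have h := norm_eq_of_mem_cells hs ht hxs hxt
    rw [norm_sub_eq_iff 0] at h ⊢
    rw [← h]
    simp [dot]
    ring
  have hall : ∀ᶠ r : ℝ in 𝓝 0, ∀ u ∈ T, ‖x + (r : ℂ) * (Complex.I * (t - s)) - s‖ ≤
      ‖x + (r : ℂ) * (Complex.I * (t - s)) - u‖ := by
    rw [Filter.eventually_all_finite hT]
    intro u hu
    by_cases hus : u = s
    · subst hus; exact Filter.Eventually.of_forall fun _ => le_rfl
    by_cases hut : u = t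
    · subst hut; exact Filter.Eventually.of_forall fun r => (heq r).le
    have hlt : ‖x - s‖ < ‖x - u‖ := by
      by_contra! h
      exact hx (mem_vertices hs ht hu hst hus hut hxs hxt (mem_cell_of_le hxs h))
    have h1 : Continuous fun r : ℝ => ‖x + (r : ℂ) * (Complex.I * (t - s)) - s‖ := by fun_prop
    have h2 : Continuous fun r : ℝ => ‖x + (r : ℂ) * (Complex.I * (t - s)) - u‖ := by fun_prop
    have := h1.continuousAt.eventually_lt h2.continuousAt (x₀ := 0) (by simpa using hlt)
    exact this.mono fun r hr => hr.le
  exact hall.mono fun r hr => ⟨hr, fun u hu => (heq r).symm.le.trans (hr u hu)⟩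

/-- In the coordinate `L` along the bisector, `E` is compact and connected, so an interval. Its ends
are vertices, because at any other point `E` continues both ways; as `x` is not a vertex, the
interval is nondegenerate. -/
theorem exists_segment_of_notMem_vertices (hT : T.Finite) {s t x : ℂ} (hs : s ∈ T) (ht : t ∈ T)
    (hst : s ≠ t) (hxs : x ∈ cell T s) (hxt : x ∈ cell T t) (hx : x ∉ vertices T)
    (hcomp : IsCompact (cell T s ∩ cell T t)) :
    ∃ v ∈ vertices T, ∃ w ∈ vertices T, v ≠ w ∧ cell T s ∩ cell T t = segment ℝ v w := by
  set E := cell T s ∩ cell T t with hE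
  let d : ℂ := Complex.I * (t - s)
  have hd : Complex.normSq d ≠ 0 := by
    rw [Ne, Complex.normSq_eq_zero]
    exact mul_ne_zero Complex.I_ne_zero (sub_ne_zero.mpr hst.symm)
  let φ : ℝ → ℂ := fun r => x + (r : ℂ) * d
  let L : ℂ → ℝ := fun y => dot (y - x) d / Complex.normSq d
  have hLφ : ∀ r, L (φ r) = r := fun r => by
    simp only [L, φ]
    rw [div_eq_iff hd]
    simp [dot, Complex.normSq_apply]
    ring
  have hLc : Continuous L := by
    have h1 : Continuous fun y : ℂ => y.re := Complex.continuous_re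
    have h2 : Continuous fun y : ℂ => y.im := Complex.continuous_im
    simp only [L, dot, Complex.sub_re, Complex.sub_im]
    fun_prop
  have hφL : ∀ y ∈ E, φ (L y) = y := fun y hy => by
    have e1 := norm_eq_of_mem_cells hs ht hxs hxt
    have e2 := norm_eq_of_mem_cells hs ht hy.1 hy.2
    rw [norm_sub_eq_iff 0] at e1 e2
    have e3 : dot (y - x) (t - s) = 0 := by
      simp [dot] at e1 e2 ⊢
      linarith
    have hn : Complex.normSq d = (t.re - s.re) ^ 2 + (t.im - s.im) ^ 2 := by
      simp [d, Complex.normSq_apply]; ring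
    have hL : L y * Complex.normSq d = dot (y - x) d := div_mul_cancel₀ _ hd
    rw [hn] at hd hL
    have hre : (φ (L y)).re = x.re + L y * (s.im - t.im) := by simp [φ, d]
    have him : (φ (L y)).im = x.im + L y * (t.re - s.re) := by simp [φ, d]
    simp [dot, d] at e3 hL
    apply Complex.ext
    · rw [hre]
      refine mul_right_cancel₀ hd ?_
      linear_combination (s.im - t.im) * hL - (t.re - s.re) * e3
    · rw [him]
      refine mul_right_cancel₀ hd ?_
      linear_combination (t.re - s.re) * hL - (t.im - s.im) * e3
  have hconv : Convex ℝ E := (convex_cell T s).inter (convex_cell T t)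
  have hconn : IsConnected (L '' E) :=
    (hconv.isConnected ⟨x, hxs, hxt⟩).image L hLc.continuousOn
  have hIcc := eq_Icc_of_connected_compact hconn (hcomp.image hLc)
  set α := sInf (L '' E)
  set β := sSup (L '' E)
  have hmem : ∀ r, φ r ∈ E ↔ r ∈ Set.Icc α β := fun r => by
    rw [← hIcc]
    constructor
    · exact fun h => ⟨_, h, hLφ r⟩
    · rintro ⟨y, hy, rfl⟩
      rwa [hφL y hy]
  have hφadd : ∀ r q : ℝ, φ (r + q) = φ r + (q : ℂ) * (Complex.I * (t - s)) := fun r q => by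
    simp only [φ, d]; push_cast; ring
  have hext : ∀ r, φ r ∈ E → φ r ∉ vertices T → α < r ∧ r < β := fun r hr hv => by
    have h := eventually_mem_cells hT hs ht hst hr.1 hr.2 hv
    simp only [← hφadd] at h
    obtain ⟨ε, hε, hball⟩ := Metric.eventually_nhds_iff.mp h
    have h1 := (hmem _).mp (hball (y := ε / 2) (by
      rw [Real.dist_eq, sub_zero, abs_of_pos (by linarith)]; linarith))
    have h2 := (hmem _).mp (hball (y := -(ε / 2)) (by
      rw [Real.dist_eq, sub_zero, abs_neg, abs_of_pos (by linarith)]; linarith))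
    exact ⟨by linarith [h2.1], by linarith [h1.2]⟩
  have hφ0 : φ 0 = x := by simp [φ]
  have h0 := hext 0 (by rw [hφ0]; exact ⟨hxs, hxt⟩) (by rwa [hφ0])
  have hαβ : α ≤ β := (h0.1.trans h0.2).le
  refine ⟨φ α, ?_, φ β, ?_, ?_, ?_⟩
  · by_contra hv
    exact lt_irrefl _ (hext α ((hmem _).mpr ⟨le_rfl, hαβ⟩) hv).1
  · by_contra hv
    exact lt_irrefl _ (hext β ((hmem _).mpr ⟨hαβ, le_rfl⟩) hv).2
  · intro h
    have := congrArg L h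
    rw [hLφ, hLφ] at this
    exact (h0.1.trans h0.2).ne this
  · have hEeq : E = φ '' Set.Icc α β := by
      ext y
      constructor
      · exact fun hy => ⟨L y, hIcc ▸ ⟨y, hy, rfl⟩, hφL y hy⟩
      · rintro ⟨r, hr, rfl⟩
        exact (hmem r).mpr hr
    have hφa : φ = fun r => (AffineMap.lineMap x (x + d) : ℝ →ᵃ[ℝ] ℂ) r := by
      funext r
      simp [φ, AffineMap.lineMap_apply]
      ring
    rw [hEeq, hφa, ← segment_eq_Icc hαβ]
    exact image_segment ℝ (AffineMap.lineMap x (x + d) : ℝ →ᵃ[ℝ] ℂ) α β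

end Voronoi

/-! ### Splittings of the set of sites -/

section Splittings

open Topology

theorem continuous_dot_left (w : ℂ) : Continuous fun z : ℂ => dot z w := by
  have h1 : Continuous fun y : ℂ => y.re := Complex.continuous_re
  have h2 : Continuous fun y : ℂ => y.im := Complex.continuous_im
  unfold dot
  fun_prop

theorem dot_smul_left (c : ℝ) (z w : ℂ) : dot (c • z) w = c * dot z w := by
  simp [dot]; ring

theorem dot_sub_swap (z s t : ℂ) : dot z (s - t) = -dot z (t - s) := by
  simp [dot]; ring

/-- A splitting of the sites into inner and outer sites, for which the union of the cells of the
inner sites is a compact neighbourhood of `base` that is star-shaped with respect to `base`. -/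
structure Splitting (T : Set ℂ) where
  /-- The inner sites. -/
  inner : Finset ℂ
  /-- The outer sites. -/
  outer : Finset ℂ
  /-- The centre of the star-shaped region. -/
  base : ℂ
  nonempty : inner.Nonempty
  union : (inner : Set ℂ) ∪ outer = T
  -- `lt` puts `base` strictly on the inner side of each bisector. By `pos`, every ray from `base`
  -- leaves the inner region.
  lt : ∀ s ∈ inner, ∀ t ∈ outer, Complex.normSq (s - base) < Complex.normSq (t - base)
  pos : ∀ s ∈ inner, ∀ y : ℂ, y ≠ 0 → ∃ t ∈ outer, 0 < dot y (t - s)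

namespace Splitting

variable {T : Set ℂ} (P : Splitting T)

theorem outer_nonempty : P.outer.Nonempty := by
  obtain ⟨s, hs⟩ := P.nonempty
  obtain ⟨t, ht, -⟩ := P.pos s hs 1 one_ne_zero
  exact ⟨t, ht⟩

theorem inner_mem {s : ℂ} (hs : s ∈ P.inner) : s ∈ T := P.union ▸ Or.inl hs

theorem outer_mem {t : ℂ} (ht : t ∈ P.outer) : t ∈ T := P.union ▸ Or.inr ht

theorem ne {s t : ℂ} (hs : s ∈ P.inner) (ht : t ∈ P.outer) : s ≠ t := by
  rintro rfl
  exact lt_irrefl _ (P.lt s hs s ht)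

theorem finite {T : Set ℂ} (P : Splitting T) : T.Finite :=
  P.union ▸ P.inner.finite_toSet.union P.outer.finite_toSet

/-- The linear functional that equals `1` on the bisector of `s` and `t`. -/
def functional (s t y : ℂ) : ℝ :=
  2 * dot y (t - s) / (Complex.normSq (t - P.base) - Complex.normSq (s - P.base))

theorem functional_smul (s t y : ℂ) (c : ℝ) :
    P.functional s t (c • y) = c * P.functional s t y := by
  rw [functional, functional, dot_smul_left]; ring

theorem functional_le_one_iff {s t : ℂ} (hs : s ∈ P.inner) (ht : t ∈ P.outer) (x : ℂ) :
    P.functional s t (x - P.base) ≤ 1 ↔ ‖x - s‖ ≤ ‖x - t‖ := by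
  rw [functional, div_le_one (sub_pos.mpr (P.lt s hs t ht)), ← norm_sub_le_iff]

theorem one_le_functional_iff {s t : ℂ} (hs : s ∈ P.inner) (ht : t ∈ P.outer) (x : ℂ) :
    1 ≤ P.functional s t (x - P.base) ↔ ‖x - t‖ ≤ ‖x - s‖ := by
  rw [functional, one_le_div (sub_pos.mpr (P.lt s hs t ht)), norm_sub_le_iff P.base,
    dot_sub_swap]
  constructor <;> intro h <;> linarith

/-- The gauge of the union of the cells of the inner sites. -/
def gauge (y : ℂ) : ℝ :=
  P.inner.inf' P.nonempty fun s => P.outer.sup' P.outer_nonempty fun t => P.functional s t y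

theorem gauge_le_iff (y : ℂ) (c : ℝ) :
    P.gauge y ≤ c ↔ ∃ s ∈ P.inner, ∀ t ∈ P.outer, P.functional s t y ≤ c := by
  simp [gauge, Finset.inf'_le_iff, Finset.sup'_le_iff]

theorem le_gauge_iff (y : ℂ) (c : ℝ) :
    c ≤ P.gauge y ↔ ∀ s ∈ P.inner, ∃ t ∈ P.outer, c ≤ P.functional s t y := by
  simp [gauge, Finset.le_inf'_iff, Finset.le_sup'_iff]

theorem continuous_gauge : Continuous P.gauge := by
  refine Continuous.finset_inf'_apply _ fun s _ => Continuous.finset_sup'_apply _ fun t _ => ?_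
  exact ((continuous_dot_left _).const_mul 2).div_const _

theorem gauge_smul {c : ℝ} (hc : 0 < c) (y : ℂ) : P.gauge (c • y) = c * P.gauge y := by
  have key : ∀ {c : ℝ}, 0 < c → ∀ y, P.gauge (c • y) ≤ c * P.gauge y := fun {c} hc y => by
    obtain ⟨s, hs, h⟩ := (P.gauge_le_iff y _).mp le_rfl
    refine (P.gauge_le_iff _ _).mpr ⟨s, hs, fun t ht => ?_⟩
    rw [functional_smul]
    exact mul_le_mul_of_nonneg_left (h t ht) hc.le
  refine le_antisymm (key hc y) ?_
  have h := key (inv_pos.mpr hc) (c • y)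
  rw [smul_smul, inv_mul_cancel₀ hc.ne', one_smul] at h
  calc c * P.gauge y ≤ c * (c⁻¹ * P.gauge (c • y)) := mul_le_mul_of_nonneg_left h hc.le
    _ = P.gauge (c • y) := by rw [← mul_assoc, mul_inv_cancel₀ hc.ne', one_mul]

theorem gauge_pos {y : ℂ} (hy : y ≠ 0) : 0 < P.gauge y := by
  by_contra! h
  obtain ⟨s, hs, h⟩ := (P.gauge_le_iff _ _).mp h
  obtain ⟨t, ht, hpos⟩ := P.pos s hs y hy
  have := h t ht
  rw [functional] at this
  exact absurd this (not_le.mpr (div_pos (by linarith) (sub_pos.mpr (P.lt s hs t ht))))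

theorem gauge_zero : P.gauge 0 = 0 := by
  have h : ∀ s t, P.functional s t 0 = 0 := fun s t => by simp [functional, dot]
  obtain ⟨s, hs⟩ := P.nonempty
  obtain ⟨t, ht⟩ := P.outer_nonempty
  exact le_antisymm ((P.gauge_le_iff _ _).mpr ⟨s, hs, fun t _ => (h s t).le⟩)
    ((P.le_gauge_iff _ _).mpr fun s _ => ⟨t, ht, (h s t).ge⟩)

/-- If some inner site is at most as far from `x` as every outer site, then the nearest inner site
is nearest among all sites. -/
theorem gauge_le_one_iff (x : ℂ) : P.gauge (x - P.base) ≤ 1 ↔ ∃ s ∈ P.inner, x ∈ cell T s := by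
  rw [gauge_le_iff]
  constructor
  · rintro ⟨s, hs, h⟩
    obtain ⟨s', hs', hmin⟩ := P.inner.exists_min_image (fun s => ‖x - s‖) P.nonempty
    refine ⟨s', hs', fun t ht => ?_⟩
    rw [← P.union] at ht
    rcases ht with ht | ht
    · exact hmin t ht
    · exact (hmin s hs).trans ((P.functional_le_one_iff hs ht x).mp (h t ht))
  · rintro ⟨s, hs, h⟩
    exact ⟨s, hs, fun t ht => (P.functional_le_one_iff hs ht x).mpr (h t (P.outer_mem ht))⟩

theorem one_le_gauge_iff (x : ℂ) : 1 ≤ P.gauge (x - P.base) ↔ ∃ t ∈ P.outer, x ∈ cell T t := by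
  rw [le_gauge_iff]
  constructor
  · intro h
    obtain ⟨t', ht', hmin⟩ := P.outer.exists_min_image (fun s => ‖x - s‖) P.outer_nonempty
    refine ⟨t', ht', fun s hs => ?_⟩
    rw [← P.union] at hs
    rcases hs with hs | hs
    · obtain ⟨t, ht, hst⟩ := h s hs
      exact (hmin t ht).trans ((P.one_le_functional_iff hs ht x).mp hst)
    · exact hmin s hs
  · rintro ⟨t, ht, h⟩ s hs
    exact ⟨t, ht, (P.one_le_functional_iff hs ht x).mpr (h s (P.inner_mem hs))⟩

/-- The common boundary of the two regions of a splitting. -/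
def boundary : Set ℂ := {x | P.gauge (x - P.base) = 1}

theorem mem_boundary_iff (x : ℂ) :
    x ∈ P.boundary ↔ ∃ s ∈ P.inner, ∃ t ∈ P.outer, x ∈ cell T s ∩ cell T t := by
  rw [boundary, Set.mem_ofPred_eq, le_antisymm_iff, gauge_le_one_iff, one_le_gauge_iff]
  exact ⟨fun ⟨⟨s, hs, hxs⟩, t, ht, hxt⟩ => ⟨s, hs, t, ht, hxs, hxt⟩,
    fun ⟨s, hs, t, ht, hxs, hxt⟩ => ⟨⟨s, hs, hxs⟩, t, ht, hxt⟩⟩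

theorem continuous_gauge_sub : Continuous fun x => P.gauge (x - P.base) :=
  P.continuous_gauge.comp (continuous_id.sub continuous_const)

theorem sub_base_ne_zero {x : ℂ} (hx : x ∈ P.boundary) : x - P.base ≠ 0 := by
  intro h
  rw [boundary, Set.mem_ofPred_eq, h, gauge_zero] at hx
  exact zero_ne_one hx

theorem gauge_ray {x : ℂ} (hx : x ∈ P.boundary) {r : ℝ} (hr : 0 < r) :
    P.gauge (P.base + r • (x - P.base) - P.base) = r := by
  rw [add_sub_cancel_left, P.gauge_smul hr, show P.gauge (x - P.base) = 1 from hx, mul_one]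

theorem mem_closure_ray {x : ℂ} {U : Set ℂ} {J : Set ℝ}
    (hJ : (1 : ℝ) ∈ closure J) (h : ∀ r ∈ J, P.base + r • (x - P.base) ∈ U) : x ∈ closure U := by
  have hc : Continuous fun r : ℝ => P.base + r • (x - P.base) := by fun_prop
  have := map_mem_closure hc hJ h
  simpa using this

theorem one_mem_closure_Ioi : (1 : ℝ) ∈ closure (Set.Ioi 1) := by
  rw [closure_Ioi]; exact Set.self_mem_Ici

theorem one_mem_closure_Ioo : (1 : ℝ) ∈ closure (Set.Ioo 0 1) := by
  rw [closure_Ioo zero_ne_one]; exact ⟨zero_le_one, le_rfl⟩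

/-- On the ray through a boundary point the gauge is the ray parameter, so the point is a limit of
points with larger gauge. -/
theorem frontier_inner : frontier {x | P.gauge (x - P.base) ≤ 1} = P.boundary := by
  refine Set.Subset.antisymm (frontier_le_subset_eq P.continuous_gauge_sub continuous_const)
    fun x hx => ?_
  rw [frontier_eq_closure_inter_closure]
  refine ⟨subset_closure (le_of_eq hx), P.mem_closure_ray one_mem_closure_Ioi fun r hr => ?_⟩
  have hr' : (1 : ℝ) < r := hr
  rw [Set.mem_compl_iff, Set.mem_ofPred_eq, P.gauge_ray hx (by linarith)]
  linarith

theorem frontier_outer : frontier {x | 1 ≤ P.gauge (x - P.base)} = P.boundary := by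
  refine Set.Subset.antisymm ((frontier_le_subset_eq continuous_const P.continuous_gauge_sub).trans
    fun x hx => Eq.symm hx) fun x hx => ?_
  rw [frontier_eq_closure_inter_closure]
  refine ⟨subset_closure (ge_of_eq hx), P.mem_closure_ray one_mem_closure_Ioo fun r hr => ?_⟩
  rw [Set.mem_compl_iff, Set.mem_ofPred_eq, P.gauge_ray hx hr.1]
  linarith [hr.2]

/-- The radial projection to the boundary. -/
def proj (x : ℂ) : ℂ := P.base + (P.gauge (x - P.base))⁻¹ • (x - P.base)

theorem proj_mem {x : ℂ} (hx : x ≠ P.base) : P.proj x ∈ P.boundary := by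
  have h := P.gauge_pos (sub_ne_zero.mpr hx)
  rw [boundary, Set.mem_ofPred_eq, proj, add_sub_cancel_left, P.gauge_smul (inv_pos.mpr h),
    inv_mul_cancel₀ h.ne']

theorem proj_of_mem {x : ℂ} (hx : x ∈ P.boundary) : P.proj x = x := by
  rw [proj, show P.gauge (x - P.base) = 1 from hx]; simp

theorem continuousAt_proj {x : ℂ} (hx : x ≠ P.base) : ContinuousAt P.proj x := by
  have h := P.gauge_pos (sub_ne_zero.mpr hx)
  have h1 : ContinuousAt (fun x => P.gauge (x - P.base)) x := P.continuous_gauge_sub.continuousAt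
  exact continuousAt_const.add ((h1.inv₀ h.ne').smul
    (continuousAt_id.sub continuousAt_const))

theorem eq_ray {x : ℂ} (hx : x ≠ P.base) :
    x = P.base + P.gauge (x - P.base) • (P.proj x - P.base) := by
  have h := P.gauge_pos (sub_ne_zero.mpr hx)
  rw [proj, add_sub_cancel_left, smul_smul, mul_inv_cancel₀ h.ne', one_smul]
  ring

theorem proj_ray {x : ℂ} (hx : x ∈ P.boundary) {r : ℝ} (hr : 0 < r) :
    P.proj (P.base + r • (x - P.base)) = x := by
  rw [proj, P.gauge_ray hx hr, add_sub_cancel_left, smul_smul, inv_mul_cancel₀ hr.ne', one_smul]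
  ring

theorem boundary_eq_image : P.boundary = P.proj '' Metric.sphere P.base 1 := by
  refine Set.Subset.antisymm (fun x hx => ?_) ?_
  · have h : 0 < ‖x - P.base‖ := norm_pos_iff.mpr (P.sub_base_ne_zero hx)
    refine ⟨P.base + ‖x - P.base‖⁻¹ • (x - P.base), ?_, P.proj_ray hx (inv_pos.mpr h)⟩
    rw [mem_sphere_iff_norm, add_sub_cancel_left, norm_smul, norm_inv, norm_norm,
      inv_mul_cancel₀ h.ne']
  · rintro _ ⟨x, hx, rfl⟩
    refine P.proj_mem ?_
    rintro rfl
    simp at hx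

theorem continuousOn_proj_sphere : ContinuousOn P.proj (Metric.sphere P.base 1) :=
  fun x hx => (P.continuousAt_proj (by rintro rfl; simp at hx)).continuousWithinAt

theorem isCompact_boundary : IsCompact P.boundary := by
  rw [boundary_eq_image]
  exact (isCompact_sphere _ _).image_of_continuousOn P.continuousOn_proj_sphere

theorem isPreconnected_boundary : IsPreconnected P.boundary := by
  rw [boundary_eq_image]
  exact (isPreconnected_sphere (by simp) _ _).image _ P.continuousOn_proj_sphere

end Splitting
end Splittings

/-! ### The boundary cycle of a splitting -/

section BoundaryGraph

open Topology

theorem cross_ray (x z : ℂ) (r : ℝ) : cross x (r • z) = r * cross x z := by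
  simp [cross]; ring

theorem eq_endpoint_of_mem_segment {T : Set ℂ} {v w u : vertices T} (h : (graph T).Adj v w)
    (hu : (u : ℂ) ∈ segment ℝ (v : ℂ) w) : u = v ∨ u = w := by
  obtain ⟨-, s, hs, t, ht, hst, he⟩ := h
  exact (eq_endpoint_of_mem_vertices hs ht hst he u.2 hu).imp Subtype.ext Subtype.ext

/-- A point that is not a vertex lies in at most two cells, so the two sites of both edges coincide.
-/
theorem segment_eq_of_mem_of_mem {T : Set ℂ} {v w v' w' : vertices T} (h : (graph T).Adj v w)
    (h' : (graph T).Adj v' w') {x : ℂ} (hx : x ∉ vertices T)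
    (hxe : x ∈ segment ℝ (v : ℂ) w) (hxe' : x ∈ segment ℝ (v' : ℂ) w') :
    segment ℝ (v : ℂ) w = segment ℝ (v' : ℂ) w' := by
  obtain ⟨-, s, hs, t, ht, hst, he⟩ := h
  obtain ⟨-, s', hs', t', ht', hst', he'⟩ := h'
  rw [← he] at hxe ⊢
  rw [← he'] at hxe' ⊢
  have key : ∀ u ∈ T, x ∈ cell T u → u = s ∨ u = t := fun u hu hxu => by
    by_contra! hne
    exact hx (mem_vertices hs ht hu hst hne.1 hne.2 hxe.1 hxe.2 hxu)
  rcases key s' hs' hxe'.1 with rfl | rfl <;> rcases key t' ht' hxe'.2 with rfl | rfl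
  · exact absurd rfl hst'
  · rfl
  · exact Set.inter_comm _ _
  · exact absurd rfl hst'

/-- Two edges with a common point have a common endpoint. -/
theorem exists_common_endpoint {T : Set ℂ} {v w v' w' : vertices T} (h : (graph T).Adj v w)
    (h' : (graph T).Adj v' w') {x : ℂ} (hxe : x ∈ segment ℝ (v : ℂ) w)
    (hxe' : x ∈ segment ℝ (v' : ℂ) w') : ∃ u, (u = v ∨ u = w) ∧ (u = v' ∨ u = w') := by
  by_cases hx : x ∈ vertices T
  · exact ⟨⟨x, hx⟩, eq_endpoint_of_mem_segment h hxe, eq_endpoint_of_mem_segment h' hxe'⟩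
  · refine ⟨v, Or.inl rfl, eq_endpoint_of_mem_segment h' ?_⟩
    rw [← segment_eq_of_mem_of_mem h h' hx hxe hxe']
    exact left_mem_segment ℝ _ _

namespace Splitting

variable {T : Set ℂ} (P : Splitting T)

/-- The part of the Voronoi graph that is contained in the boundary. -/
def boundaryGraph : SimpleGraph (vertices T) where
  Adj v w := v ≠ w ∧ ∃ s ∈ P.inner, ∃ t ∈ P.outer, cell T s ∩ cell T t = segment ℝ (v : ℂ) w
  symm := ⟨by
    rintro v w ⟨hne, s, hs, t, ht, h⟩
    exact ⟨hne.symm, s, hs, t, ht, by rw [h, segment_symm]⟩⟩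
  loopless := ⟨fun _ h => h.1 rfl⟩

theorem boundaryGraph_le : P.boundaryGraph ≤ graph T := by
  rintro v w ⟨hne, s, hs, t, ht, h⟩
  exact ⟨hne, s, P.inner_mem hs, t, P.outer_mem ht, P.ne hs ht, h⟩

variable {P}

theorem segment_subset_boundary {v w : vertices T} (h : P.boundaryGraph.Adj v w) :
    segment ℝ (v : ℂ) w ⊆ P.boundary := by
  obtain ⟨-, s, hs, t, ht, he⟩ := h
  exact fun x hx => (P.mem_boundary_iff x).mpr ⟨s, hs, t, ht, he ▸ hx⟩

theorem eq_endpoint {v w u : vertices T} (h : P.boundaryGraph.Adj v w)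
    (hu : (u : ℂ) ∈ segment ℝ (v : ℂ) w) : u = v ∨ u = w :=
  eq_endpoint_of_mem_segment (P.boundaryGraph_le h) hu

theorem exists_edge_of_notMem_vertices {x : ℂ} (hx : x ∈ P.boundary) (hxV : x ∉ vertices T) :
    ∃ v w : vertices T, P.boundaryGraph.Adj v w ∧ x ∈ segment ℝ (v : ℂ) w := by
  obtain ⟨s, hs, t, ht, hxs, hxt⟩ := (P.mem_boundary_iff x).mp hx
  have hc : IsCompact (cell T s ∩ cell T t) :=
    P.isCompact_boundary.of_isClosed_subset ((isClosed_cell T s).inter (isClosed_cell T t))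
      fun y hy => (P.mem_boundary_iff y).mpr ⟨s, hs, t, ht, hy⟩
  obtain ⟨v, hv, w, hw, hvw, he⟩ := exists_segment_of_notMem_vertices P.finite (P.inner_mem hs)
    (P.outer_mem ht) (P.ne hs ht) hxs hxt hxV hc
  exact ⟨⟨v, hv⟩, ⟨w, hw⟩, ⟨fun h => hvw (congrArg Subtype.val h), s, hs, t, ht, he⟩,
    he ▸ ⟨hxs, hxt⟩⟩

theorem cross_self (z : ℂ) : cross z z = 0 := by
  simp [cross]; ring

theorem cross_add_right (z u w : ℂ) : cross z (u + w) = cross z u + cross z w := by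
  simp [cross]; ring

theorem cross_I_mul (z : ℂ) (r : ℝ) : cross z (r • (Complex.I * z)) = r * Complex.normSq z := by
  simp [cross, Complex.normSq_apply]; ring

/-- The sign of `cross` tells on which side of the line through the base and `v` a point lies. Step
from `v` perpendicularly to that side and project back to the boundary: for small steps the result
is no vertex, so it lies on an edge, and this edge must end in `v`. -/
theorem exists_adj_of_side {v : vertices T} (hv : (v : ℂ) ∈ P.boundary) {e : ℝ} (he : e ≠ 0) :
    ∃ w, P.boundaryGraph.Adj v w ∧ 0 < e * cross (v - P.base) (w - P.base) := by
  have hv0 := P.sub_base_ne_zero hv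
  have hvb : (v : ℂ) ≠ P.base := sub_ne_zero.mp hv0
  have hn : 0 < Complex.normSq (v - P.base) := Complex.normSq_pos.mpr hv0
  let m : ℝ → ℂ := fun r => v + (e * r) • (Complex.I * (v - P.base))
  have hm0 : m 0 = v := by simp [m]
  have hmc : Continuous m := by fun_prop
  have hcr : ∀ r, cross (v - P.base) (m r - P.base) = e * r * Complex.normSq (v - P.base) := by
    intro r
    have : m r - P.base = (v - P.base) + (e * r) • (Complex.I * (v - P.base)) := by
      simp only [m]; ring
    rw [this, cross_add_right, cross_self, cross_I_mul, zero_add]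
  have hpc : ContinuousAt (P.proj ∘ m) 0 :=
    ContinuousAt.comp (by rw [hm0]; exact P.continuousAt_proj hvb) hmc.continuousAt
  have hp0 : (P.proj ∘ m) 0 = v := by rw [Function.comp_apply, hm0, P.proj_of_mem hv]
  have hside : ∀ r > 0, 0 < e * cross (v - P.base) ((P.proj ∘ m) r - P.base) := by
    intro r hr
    have hne : m r ≠ P.base := by
      intro h
      have := hcr r
      rw [h, sub_self] at this
      simp only [cross, Complex.zero_re, Complex.zero_im, mul_zero, sub_self] at this
      exact (mul_ne_zero (mul_ne_zero he hr.ne') hn.ne') this.symm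
    have hg := P.gauge_pos (sub_ne_zero.mpr hne)
    rw [Function.comp_apply, Splitting.proj, add_sub_cancel_left, cross_ray, hcr]
    have : e * ((P.gauge (m r - P.base))⁻¹ * (e * r * Complex.normSq (v - P.base))) =
        (e ^ 2) * r * ((P.gauge (m r - P.base))⁻¹ * Complex.normSq (v - P.base)) := by ring
    rw [this]
    have := sq_pos_of_ne_zero he
    positivity
  have hnb : ∀ r > 0, m r ≠ P.base := by
    intro r hr h
    have := hside r hr
    rw [Function.comp_apply, h, Splitting.proj] at this
    simp [cross] at this
  have hV : ∀ᶠ r in 𝓝[>] (0 : ℝ), (P.proj ∘ m) r ∉ vertices T := by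
    have hfin : (vertices T \ {(v : ℂ)}).Finite := (finite_vertices P.finite).subset Set.sdiff_subset
    have hnh : (vertices T \ {(v : ℂ)})ᶜ ∈ 𝓝 ((P.proj ∘ m) 0) := by
      rw [hp0]
      exact hfin.isClosed.isOpen_compl.mem_nhds fun h => h.2 rfl
    filter_upwards [nhdsWithin_le_nhds (hpc.preimage_mem_nhds hnh), self_mem_nhdsWithin] with r hr hr0 hrV
    refine hr ⟨hrV, fun h => ?_⟩
    have := hside r hr0
    rw [Set.mem_singleton_iff.mp h, cross_self, mul_zero] at this
    exact lt_irrefl _ this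
  have hfreq : ∃ᶠ r in 𝓝[>] (0 : ℝ), ∃ p : vertices T × vertices T,
      P.boundaryGraph.Adj p.1 p.2 ∧ (P.proj ∘ m) r ∈ segment ℝ (p.1 : ℂ) p.2 ∧ 0 < r := by
    refine Filter.Eventually.frequently ?_
    filter_upwards [hV, self_mem_nhdsWithin] with r hr hr0
    obtain ⟨a, b, hab, hmem⟩ := exists_edge_of_notMem_vertices (P.proj_mem (hnb r hr0)) hr
    exact ⟨(a, b), hab, hmem, hr0⟩
  have : Finite (vertices T) := (finite_vertices P.finite).to_subtype
  -- There are finitely many edges, so one of them occurs for arbitrarily small steps; being closed,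
  -- it contains `v`.
  obtain ⟨⟨a, b⟩, hab⟩ := Filter.frequently_exists.mp hfreq
  have hadj : P.boundaryGraph.Adj a b := by
    obtain ⟨r, hr⟩ := hab.exists
    exact hr.1
  have hvab : (v : ℂ) ∈ segment ℝ (a : ℂ) b := by
    have hcl : IsClosed (segment ℝ (a : ℂ) b) := by
      rw [← convexHull_pair]
      exact (Set.toFinite _).isClosed_convexHull ℝ
    rw [← hp0]
    have ht : Filter.Tendsto (P.proj ∘ m) (𝓝[>] 0) (𝓝 ((P.proj ∘ m) 0)) :=
      hpc.tendsto.mono_left nhdsWithin_le_nhds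
    exact hcl.mem_of_frequently_of_tendsto (hab.mono fun r hr => hr.2.1) ht
  obtain ⟨r, -, hr, hr0⟩ := hab.exists
  have key : ∀ w : vertices T, P.boundaryGraph.Adj v w →
      (P.proj ∘ m) r ∈ segment ℝ (v : ℂ) w →
      ∃ w, P.boundaryGraph.Adj v w ∧ 0 < e * cross (v - P.base) (w - P.base) := by
    intro w hvw hmem
    refine ⟨w, hvw, ?_⟩
    obtain ⟨α, β, hα, hβ, hαβ, hy⟩ := hmem
    have h := hside r hr0
    have hsub : (P.proj ∘ m) r - P.base = α • ((v : ℂ) - P.base) + β • ((w : ℂ) - P.base) := by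
      rw [← hy]
      have : (α : ℂ) + β = 1 := by exact_mod_cast hαβ
      simp only [Complex.real_smul]
      linear_combination P.base * this
    rw [hsub, cross_add_right, cross_ray, cross_ray, cross_self, mul_zero, zero_add] at h
    have : 0 < β * (e * cross (v - P.base) (w - P.base)) := by linarith
    exact pos_of_mul_pos_right this hβ
  rcases eq_endpoint hadj hvab with rfl | rfl
  · exact key b hadj hr
  · exact key a hadj.symm (by rw [segment_symm]; exact hr)

theorem eq_smul_of_cross (p y z : ℂ) (h : cross y z = 0) :
    cross p y • z = cross p z • y := by
  simp only [cross] at h ⊢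
  apply Complex.ext
  · simp; linear_combination (-p.re) * h
  · simp; linear_combination (-p.im) * h

/-- The gauge is affine on the cone over an edge: it is homogeneous and equals `1` on the edge. -/
theorem gauge_add_smul {v w : vertices T} (h : P.boundaryGraph.Adj v w) {u : ℝ} (hu : 0 < u) :
    P.gauge ((v - P.base) + u • (w - P.base)) = 1 + u ∧
      P.base + (1 + u)⁻¹ • ((v - P.base) + u • (w - P.base)) ∈ segment ℝ (v : ℂ) w := by
  have h1 : 0 < 1 + u := by linarith
  have hmem : P.base + (1 + u)⁻¹ • ((v - P.base) + u • (w - P.base)) ∈ segment ℝ (v : ℂ) w := by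
    refine ⟨(1 + u)⁻¹, (1 + u)⁻¹ * u, by positivity, by positivity, by field_simp, ?_⟩
    have h2 : (1 + (u : ℂ)) ≠ 0 := by exact_mod_cast h1.ne'
    simp only [Complex.real_smul, Complex.ofReal_inv, Complex.ofReal_add, Complex.ofReal_one,
      Complex.ofReal_mul]
    field_simp
    ring
  refine ⟨?_, hmem⟩
  have hb : P.gauge _ = 1 := segment_subset_boundary h hmem
  rw [add_sub_cancel_left, P.gauge_smul (inv_pos.mpr h1)] at hb
  field_simp at hb
  exact hb

/-- Over two edges at `v` on the same side there is a common ray close to `v`. As a ray meets the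
boundary once, it hits both edges in the same point, which is not a vertex, so the edges agree. -/
theorem eq_of_adj_of_side {v w w' : vertices T} {e : ℝ} (h : P.boundaryGraph.Adj v w)
    (h' : P.boundaryGraph.Adj v w') (hs : 0 < e * cross (v - P.base) (w - P.base))
    (hs' : 0 < e * cross (v - P.base) (w' - P.base)) : w = w' := by
  obtain ⟨p, hp⟩ : ∃ p : ℂ, p = v - P.base := ⟨_, rfl⟩
  obtain ⟨q, hq⟩ : ∃ q : ℂ, q = w - P.base := ⟨_, rfl⟩
  obtain ⟨q', hq'⟩ : ∃ q : ℂ, q = w' - P.base := ⟨_, rfl⟩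
  have he : e ≠ 0 := by rintro rfl; simp at hs
  set m := e * cross q q' with hm
  -- Small enough for the ray through `p + u • q` to lie over the second edge: `u * |m|` is less
  -- than the numerator.
  let u := e * cross (v - P.base) (w' - P.base) / (2 * (|m| + 1))
  have hu : 0 < u := by positivity
  have hum : 0 < e * cross (v - P.base) (w' - P.base) + u * m := by
    have h1 : u * (2 * (|m| + 1)) = e * cross (v - P.base) (w' - P.base) :=
      div_mul_cancel₀ _ (by positivity)
    have h2 : -|m| ≤ m := neg_abs_le m
    nlinarith [abs_nonneg m]
  -- The solution of the linear equation saying that `p + u • q` and `p + u' • q'` are parallel.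
  let u' := u * (e * cross (v - P.base) (w - P.base)) /
    (e * cross (v - P.base) (w' - P.base) + u * m)
  have hu' : 0 < u' := by positivity
  have hu'm : u' * (e * cross (v - P.base) (w' - P.base) + u * m) =
    u * (e * cross (v - P.base) (w - P.base)) := div_mul_cancel₀ _ hum.ne'
  obtain ⟨g1, m1⟩ := gauge_add_smul h hu
  obtain ⟨g2, m2⟩ := gauge_add_smul h' hu'
  rw [← hp] at hs hs' hu'm g1 g2 m1 m2
  rw [← hq] at hs hu'm g1 m1
  rw [← hq'] at hs' hu'm g2 m2
  have hcr : cross (p + u • q) (p + u' • q') = 0 := by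
    refine (mul_eq_zero.mp (?_ : e * _ = 0)).resolve_left he
    have : e * cross (p + u • q) (p + u' • q') =
        u' * (e * cross p q' + u * m) - u * (e * cross p q) := by
      rw [hm]; simp [cross]; ring
    rw [this, hu'm, sub_self]
  have hsm := eq_smul_of_cross p _ _ hcr
  rw [cross_add_right, cross_add_right, cross_self, cross_ray, cross_ray, zero_add,
    zero_add] at hsm
  have hsm' : (u * (e * cross p q)) • (p + u' • q') = (u' * (e * cross p q')) • (p + u • q) := by
    have := congrArg (fun z : ℂ => e • z) hsm
    simp only [smul_smul] at this
    rw [mul_left_comm u, mul_left_comm u']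
    exact this
  have hk : 0 < u * (e * cross p q) := mul_pos hu hs
  have hk' : 0 < u' * (e * cross p q') := mul_pos hu' hs'
  have hg := congrArg P.gauge hsm'
  rw [P.gauge_smul hk, P.gauge_smul hk', g1, g2] at hg
  have hy : (1 + u')⁻¹ • (p + u' • q') = (1 + u)⁻¹ • (p + u • q) := by
    have h1 : (1 + u)⁻¹ = (u * (e * cross p q))⁻¹ * ((1 + u')⁻¹ * (u' * (e * cross p q'))) := by
      have key : ∀ K K' A B : ℝ, K ≠ 0 → A ≠ 0 → B ≠ 0 → K * B = K' * A →
          A⁻¹ = K⁻¹ * (B⁻¹ * K') := by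
        intro K K' A B hK hA hB h
        field_simp
        linarith
      exact key _ _ _ _ hk.ne' (by linarith) (by linarith) hg
    rw [h1, mul_smul, mul_smul, ← hsm', smul_comm (1 + u')⁻¹, smul_smul, inv_mul_cancel₀ hk.ne',
      one_smul]
  rw [hy] at m2
  have hyv : P.base + (1 + u)⁻¹ • (p + u • q) ∉ vertices T := by
    intro hV
    have h1 : (1 + (u : ℂ)) ≠ 0 := by
      have : 1 + u ≠ 0 := by linarith
      exact_mod_cast this
    have h2 : (u : ℂ) ≠ 0 := by exact_mod_cast hu.ne'
    have hvw : (v : ℂ) - w ≠ 0 := sub_ne_zero.mpr fun hh => h.1 (Subtype.ext hh)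
    rcases eq_endpoint (u := ⟨_, hV⟩) h m1 with hh | hh
    · have := congrArg Subtype.val hh
      simp only [hp, hq, Complex.real_smul, Complex.ofReal_inv, Complex.ofReal_add,
        Complex.ofReal_one] at this
      field_simp at this
      refine mul_ne_zero h2 hvw ?_
      linear_combination -this
    · have := congrArg Subtype.val hh
      simp only [hp, hq, Complex.real_smul, Complex.ofReal_inv, Complex.ofReal_add,
        Complex.ofReal_one] at this
      field_simp at this
      refine hvw ?_
      linear_combination this
  have hseg := segment_eq_of_mem_of_mem (P.boundaryGraph_le h) (P.boundaryGraph_le h') hyv m1 m2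
  rcases eq_endpoint h (u := w') (hseg ▸ right_mem_segment ℝ _ _) with hh | hh
  · exact absurd hh.symm h'.1
  · exact hh.symm

/-- Endpoints on one ray from the base would coincide; endpoints on opposite rays would put the
base, where the gauge is `0`, on the edge. -/
theorem cross_ne_zero {v w : vertices T} (h : P.boundaryGraph.Adj v w) :
    cross (v - P.base) (w - P.base) ≠ 0 := by
  intro hc
  have hv : (v : ℂ) ∈ P.boundary := segment_subset_boundary h (left_mem_segment ℝ _ _)
  have hw : (w : ℂ) ∈ P.boundary := segment_subset_boundary h (right_mem_segment ℝ _ _)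
  have hn : 0 < Complex.normSq (v - P.base) := Complex.normSq_pos.mpr (P.sub_base_ne_zero hv)
  obtain ⟨l, hl⟩ : ∃ l : ℝ, (w : ℂ) - P.base = l • (v - P.base) := by
    refine ⟨dot (v - P.base) (w - P.base) / Complex.normSq (v - P.base), ?_⟩
    generalize (v : ℂ) - P.base = p at *
    generalize (w : ℂ) - P.base = q at *
    simp only [cross, dot, Complex.normSq_apply] at *
    apply Complex.ext <;> simp only [Complex.real_smul, Complex.mul_re, Complex.mul_im,
      Complex.ofReal_re, Complex.ofReal_im, zero_mul, sub_zero, add_zero] <;>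
      rw [div_mul_eq_mul_div, eq_div_iff hn.ne']
    · linear_combination -p.im * hc
    · linear_combination p.re * hc
  rcases lt_or_ge 0 l with h0 | h0
  · have hg : P.gauge (w - P.base) = 1 := hw
    rw [hl, P.gauge_smul h0, show P.gauge (v - P.base) = 1 from hv, mul_one] at hg
    rw [hg, one_smul] at hl
    exact h.1 (Subtype.ext (sub_left_injective hl).symm)
  · have hb : P.base ∈ segment ℝ (v : ℂ) w := by
      have h1 : 0 < 1 - l := by linarith
      refine ⟨-l * (1 - l)⁻¹, (1 - l)⁻¹, by nlinarith [inv_pos.mpr h1], by positivity,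
        by field_simp; ring, ?_⟩
      have h2 : (1 - (l : ℂ)) ≠ 0 := by exact_mod_cast h1.ne'
      have hw' : (w : ℂ) = P.base + l * (v - P.base) := by
        rw [← Complex.real_smul, ← hl]; ring
      rw [hw']
      simp only [Complex.real_smul, Complex.ofReal_inv, Complex.ofReal_sub, Complex.ofReal_one,
        Complex.ofReal_mul, Complex.ofReal_neg]
      field_simp
      ring
    exact P.sub_base_ne_zero (segment_subset_boundary h hb) (sub_self _)

theorem mem_boundary_of_adj {v w : vertices T} (h : P.boundaryGraph.Adj v w) :
    (v : ℂ) ∈ P.boundary := segment_subset_boundary h (left_mem_segment ℝ _ _)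

theorem isCycles_boundaryGraph : P.boundaryGraph.IsCycles := by
  rintro v ⟨u, hu⟩
  have hv := mem_boundary_of_adj hu
  obtain ⟨w₁, h₁, hs₁⟩ := exists_adj_of_side hv one_ne_zero
  obtain ⟨w₂, h₂, hs₂⟩ := exists_adj_of_side hv (neg_ne_zero.mpr one_ne_zero)
  rw [Set.ncard_eq_two]
  refine ⟨w₁, w₂, ?_, ?_⟩
  · rintro rfl
    linarith
  · ext w
    simp only [SimpleGraph.mem_neighborSet, Set.mem_insert_iff, Set.mem_singleton_iff]
    constructor
    · intro hw
      rcases (cross_ne_zero hw).lt_or_gt with hlt | hgt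
      · exact Or.inr (eq_of_adj_of_side hw h₂ (e := -1) (by linarith) hs₂)
      · exact Or.inl (eq_of_adj_of_side hw h₁ (e := 1) (by linarith) hs₁)
    · rintro (rfl | rfl)
      exacts [h₁, h₂]

theorem exists_edge {x : ℂ} (hx : x ∈ P.boundary) :
    ∃ v w : vertices T, P.boundaryGraph.Adj v w ∧ x ∈ segment ℝ (v : ℂ) w := by
  by_cases hxV : x ∈ vertices T
  · obtain ⟨w, hw, -⟩ := exists_adj_of_side (v := ⟨x, hxV⟩) hx one_ne_zero
    exact ⟨_, w, hw, left_mem_segment ℝ _ _⟩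
  · exact exists_edge_of_notMem_vertices hx hxV

/-- Otherwise the edges inside and outside the component of `v` form two closed sets that cover the
connected boundary, so they meet; but edges that meet share an endpoint. -/
theorem reachable {v w : vertices T} (hv : (v : ℂ) ∈ P.boundary) (hw : (w : ℂ) ∈ P.boundary) :
    P.boundaryGraph.Reachable v w := by
  have : Finite (vertices T) := (finite_vertices P.finite).to_subtype
  by_contra hvw
  let E : Set (vertices T) → Set ℂ := fun R => ⋃ p ∈ {p : vertices T × vertices T |
    P.boundaryGraph.Adj p.1 p.2 ∧ p.1 ∈ R}, segment ℝ (p.1 : ℂ) p.2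
  let R : Set (vertices T) := {u | P.boundaryGraph.Reachable v u}
  have hE : ∀ R, IsClosed (E R) := fun R => (Set.toFinite _).isClosed_biUnion fun p _ => by
    rw [← convexHull_pair]
    exact (Set.toFinite _).isClosed_convexHull ℝ
  have hmemE : ∀ (R : Set (vertices T)) (u : vertices T), (u : ℂ) ∈ P.boundary → u ∈ R →
      (u : ℂ) ∈ E R := fun R u hu huR => by
    obtain ⟨z, hz, -⟩ := exists_adj_of_side hu one_ne_zero
    exact Set.mem_biUnion (x := (u, z)) ⟨hz, huR⟩ (left_mem_segment ℝ _ _)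
  have hcover : P.boundary ⊆ E R ∪ E Rᶜ := fun x hx => by
    obtain ⟨a, b, hab, hmem⟩ := exists_edge hx
    by_cases ha : a ∈ R
    · exact Or.inl (Set.mem_biUnion (x := (a, b)) ⟨hab, ha⟩ hmem)
    · exact Or.inr (Set.mem_biUnion (x := (a, b)) ⟨hab, ha⟩ hmem)
  obtain ⟨x, -, hx1, hx2⟩ := isPreconnected_closed_iff.mp P.isPreconnected_boundary _ _ (hE R)
    (hE Rᶜ) hcover ⟨v, hv, hmemE R v hv (SimpleGraph.Reachable.refl v)⟩
    ⟨w, hw, hmemE Rᶜ w hw hvw⟩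
  simp only [E, Set.mem_iUnion] at hx1 hx2
  obtain ⟨⟨a, b⟩, ⟨hab, ha⟩, hxab⟩ := hx1
  obtain ⟨⟨c, d⟩, ⟨hcd, hc⟩, hxcd⟩ := hx2
  obtain ⟨u, hu1, hu2⟩ := exists_common_endpoint (P.boundaryGraph_le hab)
    (P.boundaryGraph_le hcd) hxab hxcd
  have h1 : P.boundaryGraph.Reachable v u := by
    rcases hu1 with rfl | rfl
    exacts [ha, SimpleGraph.Reachable.trans ha hab.reachable]
  refine hc ?_
  rcases hu2 with rfl | rfl
  exacts [h1, SimpleGraph.Reachable.trans h1 hcd.symm.reachable]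

theorem boundary_nonempty (P : Splitting T) : P.boundary.Nonempty :=
  ⟨_, P.proj_mem (x := P.base + 1) (by simp)⟩

/-- The boundary of a splitting is traversed by a cycle. -/
theorem exists_cycle (P : Splitting T) : ∃ (v : vertices T) (c : P.boundaryGraph.Walk v v),
    c.IsCycle ∧ (∀ a b, P.boundaryGraph.Adj a b → s(a, b) ∈ c.edges) := by
  have : Finite (vertices T) := (finite_vertices P.finite).to_subtype
  obtain ⟨x, hx⟩ := P.boundary_nonempty
  obtain ⟨v, w, hvw, -⟩ := exists_edge hx
  -- The cycle visits the whole component, which contains every endpoint of a boundary edge; at each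
  -- vertex it uses both edges, so it uses all edges.
  obtain ⟨c, hc, hsupp⟩ :=
    isCycles_boundaryGraph.exists_cycle_toSubgraph_verts_eq_connectedComponentSupp
    (c := P.boundaryGraph.connectedComponentMk v) (v := v) rfl ⟨w, hvw⟩
  refine ⟨v, c, hc, fun a b hab => ?_⟩
  have : Fintype (vertices T) := Fintype.ofFinite _
  classical
  have ha : a ∈ c.toSubgraph.verts := by
    rw [hsupp, SimpleGraph.ConnectedComponent.mem_supp_iff, SimpleGraph.ConnectedComponent.eq]
    exact reachable (mem_boundary_of_adj hab) (mem_boundary_of_adj hvw)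
  rw [← SimpleGraph.Walk.mem_edges_toSubgraph, SimpleGraph.Subgraph.mem_edgeSet]
  exact (hc.adj_toSubgraph_iff_of_isCycles isCycles_boundaryGraph ha b).mpr hab

end Splitting
end BoundaryGraph

/-! ### The traces of walks -/

section Traces

variable {S : Finset ℂ} {θ : ℝ}

theorem mem_range_edgePath {v w : vertices (sites S θ)} (h : (voronoi S θ).Adj v w) (x : ℂ) :
    (∃ t, (edgePath h t : ℂ) = x) ↔ x ∈ segment ℝ (v : ℂ) w := by
  rw [segment_eq_image_lineMap]
  constructor
  · rintro ⟨t, rfl⟩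
    exact ⟨t, t.2, rfl⟩
  · rintro ⟨t, ht, rfl⟩
    exact ⟨⟨t, ht⟩, rfl⟩

theorem mem_range_trans {x y z : Punctured S} (p : Path x y) (q : Path y z) (a : ℂ) :
    (∃ t, (p.trans q t : ℂ) = a) ↔ (∃ t, (p t : ℂ) = a) ∨ ∃ t, (q t : ℂ) = a := by
  have h := Path.trans_range p q
  have key : ∀ {x y : Punctured S} (p : Path x y), (∃ t, (p t : ℂ) = a) ↔
      a ∈ Subtype.val '' Set.range p := fun p => by rw [← Set.range_comp]; rfl
  rw [key, key, key, h, Set.image_union, Set.mem_union]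

theorem mem_range_walkPath {v w : vertices (sites S θ)} (p : (voronoi S θ).Walk v w) (x : ℂ) :
    (∃ t, (walkPath p t : ℂ) = x) ↔
      x = v ∨ ∃ a b, s(a, b) ∈ p.edges ∧ x ∈ segment ℝ (a : ℂ) b := by
  induction p with
  | nil =>
    constructor
    · rintro ⟨t, rfl⟩
      exact Or.inl rfl
    · rintro (rfl | ⟨a, b, h, -⟩)
      · exact ⟨0, rfl⟩
      · simp at h
  | @cons u v w h p ih =>
    rw [walkPath, mem_range_trans, mem_range_edgePath, ih]
    constructor
    · rintro (hx | rfl | ⟨a, b, hab, hx⟩)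
      · exact Or.inr ⟨u, v, by simp, hx⟩
      · exact Or.inr ⟨u, v, by simp, right_mem_segment ℝ _ _⟩
      · exact Or.inr ⟨a, b, by simp [hab], hx⟩
    · rintro (rfl | ⟨a, b, hab, hx⟩)
      · exact Or.inl (left_mem_segment ℝ _ _)
      · rw [SimpleGraph.Walk.edges_cons, List.mem_cons, Sym2.eq_iff] at hab
        rcases hab with (⟨rfl, rfl⟩ | ⟨rfl, rfl⟩) | hab
        · exact Or.inl hx
        · exact Or.inl (by rw [segment_symm]; exact hx)
        · exact Or.inr (Or.inr ⟨a, b, hab, hx⟩)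

theorem Splitting.exists_boundary_cycle (P : Splitting (sites S θ)) :
    ∃ (v : vertices (sites S θ)) (c : (voronoi S θ).Walk v v), c.IsCycle ∧
      Set.range (fun t : I => (walkPath c t : ℂ)) = P.boundary ∧
      ∀ a b, P.boundaryGraph.Adj a b → s(a, b) ∈ c.edges := by
  obtain ⟨v, c, hc, hedges⟩ := P.exists_cycle
  have hmem : ∀ a b, P.boundaryGraph.Adj a b → s(a, b) ∈ (c.mapLe P.boundaryGraph_le).edges :=
    fun a b hab => by rw [SimpleGraph.Walk.edges_mapLe_eq_edges]; exact hedges a b hab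
  have hadj : ∀ a b, s(a, b) ∈ (c.mapLe P.boundaryGraph_le).edges → P.boundaryGraph.Adj a b :=
    fun a b hab => by
      rw [SimpleGraph.Walk.edges_mapLe_eq_edges] at hab
      exact c.adj_of_mem_edges hab
  refine ⟨v, c.mapLe P.boundaryGraph_le, (SimpleGraph.Walk.isCycle_mapLe _).mpr hc, ?_, hmem⟩
  ext x
  rw [Set.mem_range, mem_range_walkPath]
  constructor
  · rintro (rfl | ⟨a, b, hab, hx⟩)
    · cases c with
      | nil => exact absurd rfl hc.ne_nil
      | cons h p => exact Splitting.mem_boundary_of_adj h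
    · exact Splitting.segment_subset_boundary (hadj a b hab) hx
  · intro hx
    obtain ⟨a, b, hab, hxab⟩ := Splitting.exists_edge hx
    exact Or.inr ⟨a, b, hmem a b hab, hxab⟩

end Traces

/-! ### The hexagon -/

section Hexagon

/-- The hexagon as a finite set. -/
def hexagonFinset (S : Finset ℂ) (θ : ℝ) : Finset ℂ :=
  Finset.univ.image fun k : Fin 6 =>
    center S + (radius S : ℂ) * Complex.exp (((θ + (k : ℕ) * (Real.pi / 3) : ℝ) : ℂ) * Complex.I)

theorem coe_hexagonFinset (S : Finset ℂ) (θ : ℝ) : (hexagonFinset S θ : Set ℂ) = hexagon S θ := by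
  simp [hexagonFinset, hexagon]

theorem two_mul_norm_sub_center_le {S : Finset ℂ} {s : ℂ} (hs : s ∈ S) :
    2 * ‖s - center S‖ ≤ radius S := by
  have : ‖s - center S‖₊ ≤ S.sup fun s => ‖s - center S‖₊ :=
    Finset.le_sup (f := fun s => ‖s - center S‖₊) hs
  rw [radius]
  exact mul_le_mul_of_nonneg_left (NNReal.coe_le_coe.mpr this) zero_le_two

theorem radius_pos {S : Finset ℂ} (hS : 2 ≤ S.card) : 0 < radius S := by
  obtain ⟨s, hs, t, ht, hst⟩ := Finset.one_lt_card.mp (by omega : 1 < S.card)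
  have h1 := two_mul_norm_sub_center_le hs
  have h2 := two_mul_norm_sub_center_le ht
  by_contra! h
  have e1 : ‖s - center S‖ = 0 := le_antisymm (by linarith) (norm_nonneg _)
  have e2 : ‖t - center S‖ = 0 := le_antisymm (by linarith) (norm_nonneg _)
  rw [norm_sub_eq_zero_iff] at e1 e2
  exact hst (e1.trans e2.symm)

theorem normSq_hexagon {S : Finset ℂ} {θ : ℝ} {t : ℂ} (ht : t ∈ hexagon S θ) :
    Complex.normSq (t - center S) = radius S ^ 2 := by
  obtain ⟨k, rfl⟩ := ht
  rw [add_sub_cancel_left, Complex.normSq_mul, Complex.normSq_ofReal, Complex.normSq_eq_norm_sq,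
    Complex.norm_exp_ofReal_mul_I]
  ring

theorem normSq_sub_center_lt {S : Finset ℂ} (hS : 2 ≤ S.card) {s : ℂ} (hs : s ∈ S) :
    Complex.normSq (s - center S) < radius S ^ 2 := by
  rw [Complex.normSq_eq_norm_sq]
  have h1 := two_mul_norm_sub_center_le hs
  have h2 := radius_pos hS
  nlinarith [norm_nonneg (s - center S)]

theorem dot_le (y z : ℂ) : dot y z ≤ ‖y‖ * ‖z‖ := by
  have h : dot y z = (starRingEnd ℂ y * z).re := by simp [dot]
  rw [h]
  refine (Complex.re_le_norm _).trans_eq ?_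
  rw [norm_mul, Complex.norm_conj]

/-- Some direction of the hexagon makes an angle of at most 30° with `y`. Algebraically: the six
inner products `d k` satisfy `d (k + 3) = -d k`, so if all were at most `‖y‖ / 2`, the squares of
the first three would sum to at most `3‖y‖² / 4`, whereas the sum is `3‖y‖² / 2`. -/
theorem exists_direction (y : ℂ) (hy : y ≠ 0) (θ : ℝ) : ∃ k : Fin 6,
    ‖y‖ < 2 * dot y (Complex.exp (((θ + (k : ℕ) * (Real.pi / 3) : ℝ) : ℂ) * Complex.I)) := by
  have hd : ∀ α : ℝ, dot y (Complex.exp ((α : ℂ) * Complex.I)) =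
      y.re * Real.cos α + y.im * Real.sin α := fun α => by
    rw [dot, Complex.exp_ofReal_mul_I_re, Complex.exp_ofReal_mul_I_im]
  by_contra! h
  simp only [hd] at h
  obtain ⟨d, hd⟩ : ∃ d : ℕ → ℝ, ∀ k, d k = y.re * Real.cos (θ + k * (Real.pi / 3)) +
    y.im * Real.sin (θ + k * (Real.pi / 3)) := ⟨_, fun _ => rfl⟩
  have hle : ∀ k, k < 6 → 2 * d k ≤ ‖y‖ := fun k hk => by rw [hd]; exact h ⟨k, hk⟩
  have hrec : ∀ k, d (k + 2) = d (k + 1) - d k := fun k => by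
    rw [hd, hd, hd]
    obtain ⟨α, hα⟩ : ∃ α, α = θ + (k : ℝ) * (Real.pi / 3) := ⟨_, rfl⟩
    have e1 : θ + ((k + 1 : ℕ) : ℝ) * (Real.pi / 3) = α + Real.pi / 3 := by
      rw [hα]; push_cast; ring
    have e2 : θ + ((k + 2 : ℕ) : ℝ) * (Real.pi / 3) = α + Real.pi / 3 + Real.pi / 3 := by
      rw [hα]; push_cast; ring
    rw [e1, e2, ← hα]
    simp only [Real.cos_add, Real.sin_add, Real.cos_pi_div_three, Real.sin_pi_div_three]
    have h3 : Real.sqrt 3 * Real.sqrt 3 = 3 := Real.mul_self_sqrt (by norm_num)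
    linear_combination (-(y.re * Real.cos α) / 4 - y.im * Real.sin α / 4) * h3
  have h1 : d 1 = d 0 / 2 + Real.sqrt 3 / 2 * (y.im * Real.cos θ - y.re * Real.sin θ) := by
    rw [hd, hd]
    simp [Real.cos_add, Real.sin_add]
    ring
  have h0 : d 0 = y.re * Real.cos θ + y.im * Real.sin θ := by rw [hd]; simp
  have hn : ‖y‖ ^ 2 = d 0 ^ 2 + (y.im * Real.cos θ - y.re * Real.sin θ) ^ 2 := by
    rw [← Complex.normSq_eq_norm_sq, Complex.normSq_apply, h0]
    linear_combination (-(y.re ^ 2) - y.im ^ 2) * Real.sin_sq_add_cos_sq θ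
  have h3 : Real.sqrt 3 * Real.sqrt 3 = 3 := Real.mul_self_sqrt (by norm_num)
  have hsum : 2 * (d 0 ^ 2 + d 1 ^ 2 + d 2 ^ 2) = 3 * ‖y‖ ^ 2 := by
    rw [hrec 0, zero_add, hn, h1]
    linear_combination (y.im * Real.cos θ - y.re * Real.sin θ) ^ 2 * h3
  have hpos : 0 < ‖y‖ := norm_pos_iff.mpr hy
  have e3 : d 3 = -d 0 := by rw [hrec 1, hrec 0]; ring
  have e4 : d 4 = -d 1 := by rw [hrec 2, e3, hrec 0]; ring
  have e5 : d 5 = -d 2 := by rw [hrec 3, e4, e3, hrec 0]; ring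
  have hsq : ∀ x : ℝ, 2 * x ≤ ‖y‖ → 2 * -x ≤ ‖y‖ → 4 * x ^ 2 ≤ ‖y‖ ^ 2 := fun x hx1 hx2 => by
    nlinarith
  have q0 := hsq _ (hle 0 (by norm_num)) (e3 ▸ hle 3 (by norm_num))
  have q1 := hsq _ (hle 1 (by norm_num)) (e4 ▸ hle 4 (by norm_num))
  have q2 := hsq _ (hle 2 (by norm_num)) (e5 ▸ hle 5 (by norm_num))
  nlinarith

/-- The factor 2 in the radius enters here: the hexagon vertex contributes more than `radius * ‖y‖ /
2`, which is at least `‖y‖ * ‖s - center‖`. -/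
theorem exists_hexagon_pos {S : Finset ℂ} (hS : 2 ≤ S.card) (θ : ℝ) {s : ℂ} (hs : s ∈ S) {y : ℂ}
    (hy : y ≠ 0) : ∃ t ∈ hexagonFinset S θ, 0 < dot y (t - s) := by
  obtain ⟨k, hk⟩ := exists_direction y hy θ
  refine ⟨_, Finset.mem_image_of_mem _ (Finset.mem_univ k), ?_⟩
  generalize Complex.exp (((θ + (k : ℕ) * (Real.pi / 3) : ℝ) : ℂ) * Complex.I) = e at *
  have h1 : dot y (center S + (radius S : ℂ) * e - s) =
      radius S * dot y e - dot y (s - center S) := by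
    simp [dot]; ring
  have h2 := dot_le y (s - center S)
  have h3 := two_mul_norm_sub_center_le hs
  have h4 := radius_pos hS
  rw [h1]
  nlinarith [norm_nonneg y, norm_pos_iff.mpr hy]

theorem notMem_hexagon {S : Finset ℂ} (hS : 2 ≤ S.card) {θ : ℝ} {s : ℂ} (hs : s ∈ S) :
    s ∉ hexagon S θ := fun h =>
  (normSq_sub_center_lt hS hs).ne (normSq_hexagon h)

/-- The splitting of the sites into a single point of `S` and the rest. -/
def siteSplitting {S : Finset ℂ} (hS : 2 ≤ S.card) (θ : ℝ) (s : S) :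
    Splitting (sites S θ) where
  inner := {(s : ℂ)}
  outer := (S ∪ hexagonFinset S θ).erase s
  base := s
  nonempty := Finset.singleton_nonempty _
  union := by
    rw [sites, ← coe_hexagonFinset, ← Finset.coe_union, ← Finset.coe_union]
    congr 1
    rw [← Finset.insert_eq]
    exact Finset.insert_erase (Finset.mem_union_left _ s.2)
  lt := by
    intro a ha t ht
    rw [Finset.mem_singleton.mp ha, sub_self, map_zero]
    exact Complex.normSq_pos.mpr (sub_ne_zero.mpr (Finset.ne_of_mem_erase ht))
  pos := by
    intro a ha y hy
    rw [Finset.mem_singleton.mp ha]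
    obtain ⟨t, ht, hpos⟩ := exists_hexagon_pos hS θ s.2 hy
    refine ⟨t, Finset.mem_erase.mpr ⟨?_, Finset.mem_union_right _ ht⟩, hpos⟩
    rintro rfl
    simp [dot] at hpos

/-- The splitting of the sites into `S` and the hexagon. -/
def hexagonSplitting {S : Finset ℂ} (hS : 2 ≤ S.card) (θ : ℝ) : Splitting (sites S θ) where
  inner := S
  outer := hexagonFinset S θ
  base := center S
  nonempty := Finset.card_pos.mp (by omega)
  union := by rw [sites, coe_hexagonFinset]
  lt := by
    intro s hs t ht
    rw [← Finset.mem_coe, coe_hexagonFinset] at ht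
    rw [normSq_hexagon ht]
    exact normSq_sub_center_lt hS hs
  pos := fun _ hs _ hy => exists_hexagon_pos hS θ hs hy

/-- The splitting that belongs to a region. -/
def regionSplitting {S : Finset ℂ} (hS : 2 ≤ S.card) (θ : ℝ) :
    OnePoint S → Splitting (sites S θ)
  | OnePoint.infty => hexagonSplitting hS θ
  | OnePoint.some s => siteSplitting hS θ s

theorem mem_region_some_iff {S : Finset ℂ} (hS : 2 ≤ S.card) (θ : ℝ) (s : S) (x : ℂ) :
    x ∈ region S θ (OnePoint.some s) ↔
      (siteSplitting hS θ s).gauge (x - (siteSplitting hS θ s).base) ≤ 1 := by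
  rw [Splitting.gauge_le_one_iff]
  simp [region, siteSplitting]

theorem mem_region_infty_iff {S : Finset ℂ} (hS : 2 ≤ S.card) (θ : ℝ) (x : ℂ) :
    x ∈ region S θ OnePoint.infty ↔
      1 ≤ (hexagonSplitting hS θ).gauge (x - (hexagonSplitting hS θ).base) := by
  rw [Splitting.one_le_gauge_iff]
  simp only [region, hexagonSplitting, Set.mem_iUnion, exists_prop]
  refine exists_congr fun t => and_congr_left fun _ => ?_
  rw [← Finset.mem_coe, coe_hexagonFinset, sites, Set.mem_sdiff, Set.mem_union]
  constructor
  · rintro ⟨h | h, hn⟩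
    exacts [absurd h hn, h]
  · exact fun h => ⟨Or.inr h, fun hs => notMem_hexagon hS hs h⟩

theorem frontier_region {S : Finset ℂ} (hS : 2 ≤ S.card) (θ : ℝ) (i : OnePoint S) :
    frontier (region S θ i) = (regionSplitting hS θ i).boundary := by
  induction i using OnePoint.rec with
  | infty =>
    rw [show region S θ OnePoint.infty = _ from Set.ext fun x => mem_region_infty_iff hS θ x]
    exact (hexagonSplitting hS θ).frontier_outer
  | coe s =>
    rw [show region S θ (OnePoint.some s) = _ from Set.ext fun x => mem_region_some_iff hS θ s x]
    exact (siteSplitting hS θ s).frontier_inner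

end Hexagon

/-! ### Sectors over edges -/

section Sectors

open Topology

namespace Splitting

variable {T : Set ℂ} (P : Splitting T)

/-- The part of the cone over the segment from `v` to `w` on which the gauge lies in `K`. -/
def sector (K : Set ℝ) (v w : ℂ) : Set ℂ :=
  {x | x ≠ P.base ∧ P.gauge (x - P.base) ∈ K ∧ P.proj x ∈ segment ℝ v w}

variable {P}

theorem ray_mem_sector {K : Set ℝ} {v w : vertices T} (h : P.boundaryGraph.Adj v w) {z : ℂ}
    (hz : z ∈ segment ℝ (v : ℂ) w) {r : ℝ} (hr : 0 < r) (hrK : r ∈ K) :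
    P.base + r • (z - P.base) ∈ P.sector K v w := by
  have hzb := segment_subset_boundary h hz
  refine ⟨?_, ?_, ?_⟩
  · rw [Ne, add_eq_left, smul_eq_zero, not_or]
    exact ⟨hr.ne', P.sub_base_ne_zero hzb⟩
  · rwa [P.gauge_ray hzb hr]
  · rwa [P.proj_ray hzb hr]

/-- Write points as gauge times projection. As the gauge is affine over an edge, a convex
combination has the averaged gauge, and its projection is a weighted average of the projections. -/
theorem convex_sector {K : Set ℝ} (hK : Convex ℝ K) {v w : vertices T}
    (h : P.boundaryGraph.Adj v w) : Convex ℝ (P.sector K v w) := by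
  rintro x ⟨hx0, hxK, hx⟩ y ⟨hy0, hyK, hy⟩ a b ha hb hab
  have hgx := P.gauge_pos (sub_ne_zero.mpr hx0)
  have hgy := P.gauge_pos (sub_ne_zero.mpr hy0)
  have ex := P.eq_ray hx0
  have ey := P.eq_ray hy0
  generalize P.gauge (x - P.base) = r at *
  generalize P.gauge (y - P.base) = q at *
  have hm : 0 < a * r + b * q := by
    rcases ha.eq_or_lt with rfl | ha'
    · have : b = 1 := by linarith
      rw [this]; linarith
    · nlinarith [mul_pos ha' hgx, mul_nonneg hb hgy.le]
  have hz : (a * r / (a * r + b * q)) • P.proj x + (b * q / (a * r + b * q)) • P.proj y ∈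
      segment ℝ (v : ℂ) w :=
    (convex_segment _ _) hx hy (by positivity) (by positivity) (by field_simp)
  have := ray_mem_sector h hz hm (hK hxK hyK ha hb hab)
  convert this using 1
  rw [ex, ey]
  have hm' : (a * r + b * q : ℂ) ≠ 0 := by exact_mod_cast hm.ne'
  have hab' : (a : ℂ) + b = 1 := by exact_mod_cast hab
  have ex' : P.proj (P.base + r • (P.proj x - P.base)) = P.proj x := by rw [← ex]
  have ey' : P.proj (P.base + q • (P.proj y - P.base)) = P.proj y := by rw [← ey]
  rw [ex', ey']
  simp only [Complex.real_smul, Complex.ofReal_add, Complex.ofReal_mul, Complex.ofReal_div]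
  field_simp
  linear_combination P.base * hab'

theorem eventually_notMem_sector {K : Set ℝ} (hK : IsClosed K) {v w : ℂ} {x : ℂ}
    (hx : x ≠ P.base) (hxs : x ∉ P.sector K v w) : ∀ᶠ y in 𝓝 x, y ∉ P.sector K v w := by
  by_cases hg : P.gauge (x - P.base) ∈ K
  · have hp : P.proj x ∉ segment ℝ v w := fun h => hxs ⟨hx, hg, h⟩
    have hcl : IsClosed (segment ℝ v w) := by
      rw [← convexHull_pair]
      exact (Set.toFinite _).isClosed_convexHull ℝ
    filter_upwards [(P.continuousAt_proj hx).preimage_mem_nhds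
      (hcl.isOpen_compl.mem_nhds hp)] with y hy hys
    exact hy hys.2.2
  · filter_upwards [P.continuous_gauge_sub.continuousAt.preimage_mem_nhds
      (hK.isOpen_compl.mem_nhds hg)] with y hy hys
    exact hy hys.2.1

theorem exists_sector {K : Set ℝ} {x : ℂ} (hx : x ≠ P.base) (hK : P.gauge (x - P.base) ∈ K) :
    ∃ v w : vertices T, P.boundaryGraph.Adj v w ∧ x ∈ P.sector K v w := by
  obtain ⟨v, w, h, hm⟩ := exists_edge (P.proj_mem hx)
  exact ⟨v, w, h, hx, hK, hm⟩

theorem mem_sector_of_mem_boundary {K : Set ℝ} (hK : 1 ∈ K) {x v w : ℂ} (hx : x ∈ P.boundary)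
    (hs : x ∈ segment ℝ v w) : x ∈ P.sector K v w := by
  refine ⟨sub_ne_zero.mp (P.sub_base_ne_zero hx), ?_, ?_⟩
  · rwa [show P.gauge (x - P.base) = 1 from hx]
  · rwa [P.proj_of_mem hx]

end Splitting

variable {S : Finset ℂ} (hS : 2 ≤ S.card) (θ : ℝ)

/-- The range of the gauge on a region. -/
def gaugeRange : OnePoint S → Set ℝ
  | OnePoint.infty => Set.Ici 1
  | OnePoint.some _ => Set.Iic 1

theorem gaugeRange_props (i : OnePoint S) :
    Convex ℝ (gaugeRange i) ∧ IsClosed (gaugeRange i) ∧ 1 ∈ gaugeRange i := by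
  induction i using OnePoint.rec with
  | infty => exact ⟨convex_Ici 1, isClosed_Ici, Set.self_mem_Ici⟩
  | coe s => exact ⟨convex_Iic 1, isClosed_Iic, Set.self_mem_Iic⟩

/-- The sector of a region over a boundary edge. -/
def piece (a : OnePoint S × vertices (sites S θ) × vertices (sites S θ)) : Set ℂ :=
  (regionSplitting hS θ a.1).sector (gaugeRange a.1) a.2.1 a.2.2

/-- The indices of the pieces. -/
def pieceIndex : Set (OnePoint S × vertices (sites S θ) × vertices (sites S θ)) :=
  {a | (regionSplitting hS θ a.1).boundaryGraph.Adj a.2.1 a.2.2}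

variable {hS θ}

theorem mem_region_iff_gauge {i : OnePoint S} {x : ℂ} :
    x ∈ region S θ i ↔
      (regionSplitting hS θ i).gauge (x - (regionSplitting hS θ i).base) ∈ gaugeRange i := by
  induction i using OnePoint.rec with
  | infty => exact mem_region_infty_iff hS θ x
  | coe s => exact mem_region_some_iff hS θ s x

theorem convex_piece {a} (ha : a ∈ pieceIndex hS θ) : Convex ℝ (piece hS θ a) :=
  Splitting.convex_sector (gaugeRange_props _).1 ha

theorem ne_base_of_notMem {i : OnePoint S} {x : ℂ} (hx : x ∉ S) (hi : x ∈ region S θ i) :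
    x ≠ (regionSplitting hS θ i).base := by
  induction i using OnePoint.rec with
  | infty =>
    rintro rfl
    rw [mem_region_iff_gauge (hS := hS), sub_self, Splitting.gauge_zero] at hi
    exact absurd (show (1 : ℝ) ≤ 0 from hi) (by norm_num)
  | coe s =>
    rintro rfl
    exact hx s.2

theorem notMem_of_mem_piece {a} {x : ℂ} (hx : x ∈ piece hS θ a) : x ∉ S := by
  obtain ⟨i, v, w⟩ := a
  intro hxS
  have hT : x ∈ sites S θ := Or.inl hxS
  obtain ⟨h0, hr, -⟩ := hx
  have hr := mem_region_iff_gauge.mpr hr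
  induction i using OnePoint.rec with
  | infty =>
    simp only [region, Set.mem_iUnion] at hr
    obtain ⟨t, ⟨ht, htS⟩, hxt⟩ := hr
    exact htS (eq_of_mem_cell hT hxt ▸ hxS)
  | coe s => exact h0 (eq_of_mem_cell hT hr)

theorem exists_mem_region (hS : 2 ≤ S.card) (θ : ℝ) (x : ℂ) : ∃ i, x ∈ region S θ i := by
  rcases le_total ((hexagonSplitting hS θ).gauge (x - (hexagonSplitting hS θ).base)) 1 with h | h
  · obtain ⟨s, hs, hx⟩ := (Splitting.gauge_le_one_iff _ _).mp h
    exact ⟨OnePoint.some ⟨s, hs⟩, hx⟩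
  · exact ⟨OnePoint.infty, (mem_region_infty_iff hS θ x).mpr h⟩

theorem exists_mem_piece {x : ℂ} (hx : x ∉ S) : ∃ a ∈ pieceIndex hS θ, x ∈ piece hS θ a := by
  obtain ⟨i, hi⟩ := exists_mem_region hS θ x
  obtain ⟨v, w, h, hm⟩ := Splitting.exists_sector (ne_base_of_notMem (hS := hS) hx hi)
    (mem_region_iff_gauge.mp hi)
  exact ⟨(i, v, w), h, hm⟩

theorem endpoint_mem_piece {a} (ha : a ∈ pieceIndex hS θ) {v : vertices (sites S θ)}
    (hv : v = a.2.1 ∨ v = a.2.2) : (v : ℂ) ∈ piece hS θ a := by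
  have hm : (v : ℂ) ∈ segment ℝ (a.2.1 : ℂ) a.2.2 := by
    rcases hv with rfl | rfl
    exacts [left_mem_segment ℝ _ _, right_mem_segment ℝ _ _]
  exact Splitting.mem_sector_of_mem_boundary (gaugeRange_props _).2.2
    (Splitting.segment_subset_boundary ha hm) hm

theorem mem_boundary_of_mem_regions {i j : OnePoint S} (hij : i ≠ j) {x : ℂ}
    (hi : x ∈ region S θ i) (hj : x ∈ region S θ j) : x ∈ (regionSplitting hS θ i).boundary := by
  have key : ∀ {s : S} {t : ℂ}, (s : ℂ) ≠ t → t ∈ sites S θ →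
      t ∈ (siteSplitting hS θ s).outer := fun {s t} hst ht => by
    refine Finset.mem_erase.mpr ⟨hst.symm, ?_⟩
    rw [← Finset.mem_coe, Finset.coe_union, coe_hexagonFinset]
    exact ht
  rw [Splitting.mem_boundary_iff]
  induction i using OnePoint.rec with
  | infty =>
    simp only [region, Set.mem_iUnion] at hi
    obtain ⟨t, ⟨ht, htS⟩, hxt⟩ := hi
    induction j using OnePoint.rec with
    | infty => exact absurd rfl hij
    | coe s =>
      refine ⟨s, s.2, t, ?_, hj, hxt⟩
      change t ∈ hexagonFinset S θ
      rw [← Finset.mem_coe, coe_hexagonFinset]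
      exact ht.resolve_left htS
  | coe s =>
    induction j using OnePoint.rec with
    | infty =>
      simp only [region, Set.mem_iUnion] at hj
      obtain ⟨t, ⟨ht, htS⟩, hxt⟩ := hj
      exact ⟨s, Finset.mem_singleton_self _, t, key (by rintro rfl; exact htS s.2) ht, hi, hxt⟩
    | coe s' =>
      refine ⟨s, Finset.mem_singleton_self _, s', key ?_ (Or.inl s'.2), hi, hj⟩
      rintro h
      exact hij (congrArg OnePoint.some (Subtype.ext h))

/-- Within one region the projections of `x` agree, so the edges meet. A point in two regions lies
on both boundaries and is its own projection for each. -/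
theorem exists_common_endpoint_of_mem_pieces {a b} (ha : a ∈ pieceIndex hS θ)
    (hb : b ∈ pieceIndex hS θ) {x : ℂ} (hxa : x ∈ piece hS θ a) (hxb : x ∈ piece hS θ b) :
    ∃ u, (u = a.2.1 ∨ u = a.2.2) ∧ (u = b.2.1 ∨ u = b.2.2) := by
  obtain ⟨i, v, w⟩ := a
  obtain ⟨j, v', w'⟩ := b
  have h1 := Splitting.boundaryGraph_le _ ha
  have h2 := Splitting.boundaryGraph_le _ hb
  obtain ⟨-, hi, hpi⟩ := hxa
  obtain ⟨-, hj, hpj⟩ := hxb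
  by_cases hij : i = j
  · subst hij
    exact exists_common_endpoint h1 h2 hpi hpj
  · have hi := mem_region_iff_gauge.mpr hi
    have hj := mem_region_iff_gauge.mpr hj
    rw [Splitting.proj_of_mem _ (mem_boundary_of_mem_regions hij hi hj)] at hpi
    rw [Splitting.proj_of_mem _ (mem_boundary_of_mem_regions (Ne.symm hij) hj hi)] at hpj
    exact exists_common_endpoint h1 h2 hpi hpj

/-- A small ball avoids the finitely many pieces that do not contain `x`, so a piece containing `y`
also contains `x`. -/
theorem exists_ball_pieces (x : Punctured S) : ∃ r > 0,
    (∀ z ∈ Metric.ball (x : ℂ) r, z ∉ S) ∧ ∀ y ∈ Metric.ball (x : ℂ) r,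
      ∃ C ∈ piece hS θ '' pieceIndex hS θ, (x : ℂ) ∈ C ∧ y ∈ C := by
  have hfin : Finite (vertices (sites S θ)) :=
    (finite_vertices (hexagonSplitting hS θ).finite).to_subtype
  have hfin' : Finite (OnePoint S) := inferInstanceAs (Finite (Option S))
  have h1 : ∀ᶠ y in 𝓝 (x : ℂ), y ∉ S :=
    S.finite_toSet.isClosed.isOpen_compl.mem_nhds x.2
  have h2 : ∀ᶠ y in 𝓝 (x : ℂ), ∀ a, (x : ℂ) ∉ piece hS θ a → y ∉ S → y ∉ piece hS θ a := by
    rw [Filter.eventually_all]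
    intro a
    by_cases hb : (x : ℂ) = (regionSplitting hS θ a.1).base
    · obtain ⟨i, v, w⟩ := a
      induction i using OnePoint.rec with
      -- The centre of the hexagon need not belong to `S`. The outer pieces stay away from it, since
      -- the gauge is below `1` nearby.
      | infty =>
        have : ∀ᶠ y in 𝓝 (x : ℂ), (regionSplitting hS θ OnePoint.infty).gauge
            (y - (regionSplitting hS θ OnePoint.infty).base) < 1 := by
          refine (Splitting.continuous_gauge_sub _).continuousAt.eventually_lt_const ?_
          change (regionSplitting hS θ OnePoint.infty).gauge _ < 1
          rw [hb, sub_self, Splitting.gauge_zero]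
          norm_num
        filter_upwards [this] with y hy _ _ hyp
        exact absurd (show (1 : ℝ) ≤ _ from hyp.2.1) (not_le.mpr hy)
      | coe s => exact absurd (show (x : ℂ) ∈ S from hb ▸ s.2) x.2
    · by_cases hx : (x : ℂ) ∈ piece hS θ a
      · exact Filter.Eventually.of_forall fun y h => absurd hx h
      · exact (Splitting.eventually_notMem_sector (gaugeRange_props _).2.1 hb hx).mono
          fun y hy _ _ => hy
  obtain ⟨r, hr, hball⟩ := Metric.eventually_nhds_iff_ball.mp (h1.and h2)
  refine ⟨r, hr, fun z hz => (hball z hz).1, fun y hy => ?_⟩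
  obtain ⟨a, ha, hya⟩ := exists_mem_piece (hS := hS) (θ := θ) (hball y hy).1
  refine ⟨_, ⟨a, ha, rfl⟩, ?_, hya⟩
  by_contra hxa
  exact (hball y hy).2 a hxa (hball y hy).1 hya

/-- A vertex in a cell of a point of `S` lies on its boundary. Otherwise it is equidistant from
three points of the hexagon, hence is the centre, which lies in no outer cell. -/
theorem exists_pieceIndex (hS : 2 ≤ S.card) (v : vertices (sites S θ)) :
    ∃ a ∈ pieceIndex hS θ, v = a.2.1 := by
  have key : ∃ i, (v : ℂ) ∈ (regionSplitting hS θ i).boundary := by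
    have hsite : ∀ s ∈ S, ∀ t ∈ sites S θ, t ≠ s → (v : ℂ) ∈ cell (sites S θ) s →
        (v : ℂ) ∈ cell (sites S θ) t → ∃ i, (v : ℂ) ∈ (regionSplitting hS θ i).boundary := by
      intro s hs t ht hts hvs hvt
      refine ⟨OnePoint.some ⟨s, hs⟩, (Splitting.mem_boundary_iff _ _).mpr
        ⟨s, Finset.mem_singleton_self _, t, Finset.mem_erase.mpr ⟨hts, ?_⟩, hvs, hvt⟩⟩
      rw [← Finset.mem_coe, Finset.coe_union, coe_hexagonFinset]
      exact ht
    obtain ⟨s, hs, -, -, hvs⟩ := exists_third_cell v.2 0 0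
    obtain ⟨t, ht, hts, -, hvt⟩ := exists_third_cell v.2 s s
    obtain ⟨u, hu, hus, hut, hvu⟩ := exists_third_cell v.2 s t
    rcases hs with hs' | hs'
    · exact hsite s hs' t ht hts hvs hvt
    rcases ht with ht' | ht'
    · exact hsite t ht' s (Or.inr hs') hts.symm hvt hvs
    rcases hu with hu' | hu'
    · exact hsite u hu' s (Or.inr hs') hus.symm hvu hvs
    have hd : ∀ {t : ℂ}, t ∈ hexagon S θ → ‖center S - t‖ = radius S := fun {t} h => by
      have h1 := normSq_hexagon h
      rw [Complex.normSq_eq_norm_sq, norm_sub_rev] at h1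
      exact (pow_left_inj₀ (norm_nonneg _) (radius_pos hS).le two_ne_zero).mp h1
    have hvc : (v : ℂ) = center S := eq_of_equidistant hts.symm hus.symm hut.symm
      (norm_eq_of_mem_cells (Or.inr hs') (Or.inr ht') hvs hvt)
      (norm_eq_of_mem_cells (Or.inr hs') (Or.inr hu') hvs hvu)
      ((hd hs').trans (hd ht').symm) ((hd hs').trans (hd hu').symm)
    have h1 : 1 ≤ (hexagonSplitting hS θ).gauge (v - (hexagonSplitting hS θ).base) :=
      (Splitting.one_le_gauge_iff _ _).mpr ⟨s, by
        change s ∈ hexagonFinset S θ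
        rw [← Finset.mem_coe, coe_hexagonFinset]; exact hs', hvs⟩
    rw [hvc, show (hexagonSplitting hS θ).base = center S from rfl, sub_self,
      Splitting.gauge_zero] at h1
    exact absurd h1 (by norm_num)
  obtain ⟨i, hi⟩ := key
  obtain ⟨w, hw, -⟩ := Splitting.exists_adj_of_side hi one_ne_zero
  exact ⟨(i, v, w), hw, rfl⟩

end Sectors

/-! ### The fundamental group -/

section FundamentalGroup

open Path

variable {S : Finset ℂ} {θ : ℝ}

theorem walkPath_append {u v w : vertices (sites S θ)} (p : (voronoi S θ).Walk u v)
    (q : (voronoi S θ).Walk v w) :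
    Homotopic.Quotient.mk (walkPath (p.append q)) =
      (Homotopic.Quotient.mk (walkPath p)).trans (Homotopic.Quotient.mk (walkPath q)) := by
  induction p with
  | nil => simp [walkPath]
  | cons h p ih =>
    rw [SimpleGraph.Walk.cons_append, walkPath, walkPath, Homotopic.Quotient.mk_trans, Homotopic.Quotient.mk_trans, ih,
      Homotopic.Quotient.trans_assoc]

/-- A homotopy class of paths that contains a walk. -/
def IsWalkClass (v w : vertices (sites S θ)) (q : Path.Homotopic.Quotient (point v) (point w)) :
    Prop := ∃ c : (voronoi S θ).Walk v w, Homotopic.Quotient.mk (walkPath c) = q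

theorem IsWalkClass.trans {u v w : vertices (sites S θ)}
    {p : Path.Homotopic.Quotient (point u) (point v)}
    {q : Path.Homotopic.Quotient (point v) (point w)} (hp : IsWalkClass u v p)
    (hq : IsWalkClass v w q) : IsWalkClass u w (p.trans q) := by
  obtain ⟨c, rfl⟩ := hp
  obtain ⟨d, rfl⟩ := hq
  exact ⟨c.append d, walkPath_append c d⟩

theorem edgePath_mem {v w : vertices (sites S θ)} (h : (voronoi S θ).Adj v w) (t : I) :
    (edgePath h t : ℂ) ∈ segment ℝ (v : ℂ) w :=
  (mem_range_edgePath h _).mp ⟨t, rfl⟩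

variable {hS : 2 ≤ S.card}

theorem isWalkClass_of_mem_piece {a} (ha : a ∈ pieceIndex hS θ) {v w : vertices (sites S θ)}
    (hv : v = a.2.1 ∨ v = a.2.2) (hw : w = a.2.1 ∨ w = a.2.2) (p : Path (point v) (point w))
    (hp : ∀ t, (p t : ℂ) ∈ piece hS θ a) : IsWalkClass v w (Homotopic.Quotient.mk p) := by
  have hconv := convex_piece ha
  have hadj : (voronoi S θ).Adj a.2.1 a.2.2 := Splitting.boundaryGraph_le _ ha
  by_cases hvw : v = w
  · subst hvw
    refine ⟨SimpleGraph.Walk.nil, Homotopic.Quotient.eq.mpr ?_⟩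
    exact homotopic_of_convex hconv (fun z hz => notMem_of_mem_piece hz) _ _
      (fun t => endpoint_mem_piece ha hv) hp
  · have hvw' : (voronoi S θ).Adj v w := by
      rcases hv with rfl | rfl <;> rcases hw with rfl | rfl
      exacts [absurd rfl hvw, hadj, hadj.symm, absurd rfl hvw]
    refine ⟨SimpleGraph.Walk.cons hvw' SimpleGraph.Walk.nil, ?_⟩
    rw [walkPath, walkPath, Homotopic.Quotient.mk_trans, Homotopic.Quotient.mk_refl, Homotopic.Quotient.trans_refl, Homotopic.Quotient.eq]
    exact homotopic_of_convex hconv (fun z hz => notMem_of_mem_piece hz) _ _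
      (fun t => hconv.segment_subset (endpoint_mem_piece ha hv) (endpoint_mem_piece ha hw)
        (edgePath_mem hvw' t)) hp

/-- At the crossing point `x`, insert a detour to a common vertex and back; it stays in the convex
intersection of the two pieces. -/
theorem isWalkClass_trans_of_mem_pieces {a b} (ha : a ∈ pieceIndex hS θ)
    (hb : b ∈ pieceIndex hS θ) {v w : vertices (sites S θ)} (hv : v = a.2.1 ∨ v = a.2.2)
    (hw : w = b.2.1 ∨ w = b.2.2) {x : Punctured S} (p : Path (point v) x) (q : Path x (point w))
    (hp : ∀ t, (p t : ℂ) ∈ piece hS θ a) (hq : ∀ t, (q t : ℂ) ∈ piece hS θ b) :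
    IsWalkClass v w ((Homotopic.Quotient.mk p).trans (Homotopic.Quotient.mk q)) := by
  have hxa : (x : ℂ) ∈ piece hS θ a := by simpa using hp 1
  have hxb : (x : ℂ) ∈ piece hS θ b := by simpa using hq 0
  obtain ⟨u, hua, hub⟩ := exists_common_endpoint_of_mem_pieces ha hb hxa hxb
  obtain ⟨δ, hδ⟩ := exists_path_of_convex (x := x) (y := point u)
    ((convex_piece ha).inter (convex_piece hb)) (fun z hz => notMem_of_mem_piece hz.1)
    ⟨hxa, hxb⟩ ⟨endpoint_mem_piece ha hua, endpoint_mem_piece hb hub⟩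
  have h1 := isWalkClass_of_mem_piece ha hv hua (p.trans δ) (trans_mem hp fun t => (hδ t).1)
  have h2 := isWalkClass_of_mem_piece hb hub hw (δ.symm.trans q)
    (trans_mem (fun t => (hδ _).2) hq)
  have h3 := h1.trans h2
  rw [Homotopic.Quotient.mk_trans, Homotopic.Quotient.mk_trans, Homotopic.Quotient.mk_symm] at h3
  convert h3 using 1
  rw [Homotopic.Quotient.trans_assoc, ← Homotopic.Quotient.trans_assoc _ _ (Homotopic.Quotient.mk q), Homotopic.Quotient.trans_symm,
    Homotopic.Quotient.refl_trans]

/-- Ends of a chain need not be vertices, so the induction allows arbitrary connecting paths inside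
pieces. -/
theorem isWalkClass_of_isChain {x y : Punctured S} {p : Path x y}
    (hp : IsChain (piece hS θ '' pieceIndex hS θ) p) : ∀ {a b} (_ : a ∈ pieceIndex hS θ)
    (_ : b ∈ pieceIndex hS θ) {v w : vertices (sites S θ)} (_ : v = a.2.1 ∨ v = a.2.2)
    (_ : w = b.2.1 ∨ w = b.2.2) (α : Path (point v) x) (β : Path y (point w))
    (_ : ∀ t, (α t : ℂ) ∈ piece hS θ a) (_ : ∀ t, (β t : ℂ) ∈ piece hS θ b),
    IsWalkClass v w ((Homotopic.Quotient.mk α).trans ((Homotopic.Quotient.mk p).trans (Homotopic.Quotient.mk β))) := by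
  induction hp with
  | refl =>
    intro a b ha hb v w hv hw α β hα hβ
    rw [Homotopic.Quotient.mk_refl, Homotopic.Quotient.refl_trans]
    exact isWalkClass_trans_of_mem_pieces ha hb hv hw α β hα hβ
  | @snoc y z p hp δ C hC hδ ih =>
    intro a b ha hb v w hv hw α β hα hβ
    obtain ⟨c, hc, rfl⟩ := hC
    have hy : (y : ℂ) ∈ piece hS θ c := by simpa using hδ 0
    obtain ⟨ε, hε⟩ := exists_path_of_convex (x := y) (y := point c.2.1) (convex_piece hc)
      (fun z hz => notMem_of_mem_piece hz) hy (endpoint_mem_piece hc (Or.inl rfl))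
    have h1 := ih ha hc hv (Or.inl rfl) α ε hα hε
    have h2 := isWalkClass_trans_of_mem_pieces hc hb (Or.inl rfl) hw (ε.symm.trans δ) β
      (trans_mem (fun t => hε _) hδ) hβ
    have h3 := h1.trans h2
    rw [Homotopic.Quotient.mk_trans, Homotopic.Quotient.mk_symm] at h3
    rw [Homotopic.Quotient.mk_trans]
    convert h3 using 1
    simp only [Homotopic.Quotient.trans_assoc]
    rw [← Homotopic.Quotient.trans_assoc (Homotopic.Quotient.mk ε), Homotopic.Quotient.trans_symm, Homotopic.Quotient.refl_trans]
  | congr h hp ih =>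
    intro a b ha hb v w hv hw α β hα hβ
    rw [← Homotopic.Quotient.eq.mpr h]
    exact ih ha hb hv hw α β hα hβ

theorem isWalkClass_all (hS : 2 ≤ S.card) {v w : vertices (sites S θ)}
    (p : Path (point v) (point w)) : IsWalkClass v w (Homotopic.Quotient.mk p) := by
  obtain ⟨a, ha, hv⟩ := exists_pieceIndex hS v
  obtain ⟨b, hb, hw⟩ := exists_pieceIndex hS w
  have hc : IsChain (piece hS θ '' pieceIndex hS θ) p := isChain_of_cover (by
    rintro _ ⟨c, hc, rfl⟩
    exact ⟨convex_piece hc, fun z hz => notMem_of_mem_piece hz⟩) exists_ball_pieces p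
  have := isWalkClass_of_isChain hc ha hb (Or.inl hv) (Or.inl hw) (Path.refl _) (Path.refl _)
    (fun t => endpoint_mem_piece ha (Or.inl hv)) fun t => endpoint_mem_piece hb (Or.inl hw)
  simpa using this

end FundamentalGroup

section Potentials

open Topology

variable {S : Finset ℂ} {θ : ℝ} {A : Type} [AddCommGroup A]

/-! ### Potentials on the vertices of a cycle -/

theorem PathInvariant.val_edgePath_symm (q : PathInvariant (Punctured S) A)
    {v w : vertices (sites S θ)} (h : (voronoi S θ).Adj v w) :
    q.val (edgePath h.symm) = -q.val (edgePath h) := by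
  rw [← q.symm]
  refine q.homotopic (homotopic_of_convex (convex_segment (v : ℂ) (w : ℂ))
    (fun z hz hzS => segment_notMem h hz (Or.inl hzS)) _ _ (fun t => ?_) fun t => ?_)
  · rw [segment_symm]; exact edgePath_mem h.symm t
  · exact edgePath_mem h _

/-- `f` is a potential for `q` along the edges in the list `l`. -/
def IsPotentialOn (q : PathInvariant (Punctured S) A) (f : vertices (sites S θ) → A)
    (l : List (Sym2 (vertices (sites S θ)))) : Prop :=
  ∀ a b (h : (voronoi S θ).Adj a b), s(a, b) ∈ l → q.val (edgePath h) = f b - f a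

theorem isPotentialOn_of_edge (q : PathInvariant (Punctured S) A) {f : vertices (sites S θ) → A}
    {a b c d : vertices (sites S θ)} (h : (voronoi S θ).Adj a b)
    (hf : q.val (edgePath h) = f b - f a) (h' : (voronoi S θ).Adj c d) (he : s(c, d) = s(a, b)) :
    q.val (edgePath h') = f d - f c := by
  rw [Sym2.eq_iff] at he
  rcases he with ⟨rfl, rfl⟩ | ⟨rfl, rfl⟩
  · exact hf
  · rw [q.val_edgePath_symm h, hf, neg_sub]

theorem exists_isPotentialOn_path (q : PathInvariant (Punctured S) A)
    {u v : vertices (sites S θ)} (p : (voronoi S θ).Walk u v) (hp : p.IsPath) :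
    ∃ f, IsPotentialOn q f p.edges := by
  classical
  induction p with
  | nil => exact ⟨0, fun a b h hab => by simp at hab⟩
  | @cons u v w h p ih =>
    rw [SimpleGraph.Walk.cons_isPath_iff] at hp
    obtain ⟨f, hf⟩ := ih hp.1
    refine ⟨Function.update f u (f v - q.val (edgePath h)), fun a b hab he => ?_⟩
    rw [SimpleGraph.Walk.edges_cons, List.mem_cons] at he
    rcases he with he | he
    · refine isPotentialOn_of_edge q h ?_ hab he
      rw [Function.update_self, Function.update_of_ne h.ne.symm]
      abel
    · have ha : a ≠ u := by
        rintro rfl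
        exact hp.2 (p.fst_mem_support_of_mem_edges he)
      have hb : b ≠ u := by
        rintro rfl
        exact hp.2 (p.snd_mem_support_of_mem_edges he)
      rw [Function.update_of_ne ha, Function.update_of_ne hb]
      exact hf a b hab he

theorem IsPotentialOn.val_walkPath {q : PathInvariant (Punctured S) A}
    {f : vertices (sites S θ) → A} {u v : vertices (sites S θ)} {p : (voronoi S θ).Walk u v}
    (hf : IsPotentialOn q f p.edges) : q.val (walkPath p) = f v - f u := by
  induction p with
  | nil => rw [walkPath, q.refl, sub_self]
  | cons h p ih =>
    rw [walkPath, q.trans, hf _ _ h (by simp), ih fun a b hab he => hf a b hab (by simp [he])]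
    abel

/-- Removing the first edge leaves a path, on which a potential exists; vanishing on the cycle is
exactly the condition on the removed edge. -/
theorem exists_isPotentialOn_cycle (q : PathInvariant (Punctured S) A)
    {v : vertices (sites S θ)} {c : (voronoi S θ).Walk v v} (hc : c.IsCycle)
    (hq : q.val (walkPath c) = 0) : ∃ f, IsPotentialOn q f c.edges := by
  cases c with
  | nil => exact absurd rfl hc.ne_nil
  | cons h p =>
    rw [SimpleGraph.Walk.cons_isCycle_iff] at hc
    obtain ⟨f, hf⟩ := exists_isPotentialOn_path q p hc.1
    refine ⟨f, fun a b hab he => ?_⟩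
    rw [SimpleGraph.Walk.edges_cons, List.mem_cons] at he
    rcases he with he | he
    · refine isPotentialOn_of_edge q h ?_ hab he
      rw [walkPath, q.trans, hf.val_walkPath] at hq
      rw [eq_neg_of_add_eq_zero_left hq, neg_sub]
    · exact hf a b hab he

/-! ### Path invariants in convex sets with at most one puncture -/

theorem notMem_of_mem_sector_inter {hS : 2 ≤ S.card} {s : S} {C : Set ℂ}
    (hCS : ∀ z ∈ C, z ∈ S → z = s) {K : Set ℝ} {v w z : ℂ}
    (hz : z ∈ (siteSplitting hS θ s).sector K v w ∩ C) : z ∉ S :=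
  fun h => hz.1.1 (hCS z hz.2 h)

/-- The potential on the cell boundary is moved radially to anchors close to `s`, inside `C`, and
then spread over `C` sector by sector. The vertices of the graph need not lie in `C`. -/
theorem exists_potential_of_cycle (hS : 2 ≤ S.card) (q : PathInvariant (Punctured S) A) (s : S)
    {v₀ : vertices (sites S θ)} {c : (voronoi S θ).Walk v₀ v₀} (hc : c.IsCycle)
    (hq : q.val (walkPath c) = 0)
    (hedges : ∀ a b, (siteSplitting hS θ s).boundaryGraph.Adj a b → s(a, b) ∈ c.edges)
    {C : Set ℂ} (hC : Convex ℝ C) (hCo : IsOpen C) (hsC : (s : ℂ) ∈ C)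
    (hCS : ∀ z ∈ C, z ∈ S → z = s) :
    ∃ g : Punctured S → A, ∀ (x y : Punctured S) (p : Path x y), (∀ t, (p t : ℂ) ∈ C) →
      q.val p = g y - g x := by
  set P := siteSplitting hS θ s with hP
  have hbase : P.base = s := rfl
  obtain ⟨f, hf⟩ := exists_isPotentialOn_cycle q hc hq
  have hfin : Finite (vertices (sites S θ)) := (finite_vertices P.finite).to_subtype
  obtain ⟨ε, hεC, hε0, hε1⟩ : ∃ ε : ℝ, (∀ v : vertices (sites S θ),
      P.base + ε • ((v : ℂ) - P.base) ∈ C) ∧ 0 < ε ∧ ε ≤ 1 := by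
    have h1 : ∀ᶠ ε : ℝ in 𝓝[>] 0, ∀ v : vertices (sites S θ),
        P.base + ε • ((v : ℂ) - P.base) ∈ C := by
      rw [Filter.eventually_all]
      intro v
      have hcont : Continuous fun ε : ℝ => P.base + ε • ((v : ℂ) - P.base) := by fun_prop
      exact nhdsWithin_le_nhds (hcont.continuousAt.preimage_mem_nhds
        (hCo.mem_nhds (by simpa using (show P.base ∈ C from hsC))))
    have h2 : ∀ᶠ ε : ℝ in 𝓝[>] 0, ε ≤ 1 := nhdsWithin_le_nhds (Iic_mem_nhds one_pos)
    obtain ⟨ε, ⟨h1, h2⟩, h3⟩ := ((h1.and h2).and self_mem_nhdsWithin).exists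
    exact ⟨ε, h1, h3, h2⟩
  -- `T` stays in the cell and reaches the edge; `K` fills `C`. Both are convex, avoid `S` and
  -- contain the anchors of the edge.
  let T : vertices (sites S θ) → vertices (sites S θ) → Set ℂ := fun v w => P.sector (Set.Iic 1) v w
  let K : vertices (sites S θ) → vertices (sites S θ) → Set ℂ :=
    fun v w => P.sector Set.univ v w ∩ C
  have hTconv : ∀ v w, P.boundaryGraph.Adj v w → Convex ℝ (T v w) := fun v w h =>
    Splitting.convex_sector (convex_Iic 1) h
  have hKconv : ∀ v w, P.boundaryGraph.Adj v w → Convex ℝ (K v w) := fun v w h =>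
    (Splitting.convex_sector convex_univ h).inter hC
  have hTS : ∀ v w, ∀ z ∈ T v w, z ∉ S := fun v w z hz =>
    notMem_of_mem_piece (hS := hS) (a := (OnePoint.some s, v, w)) hz
  have hKS : ∀ v w, ∀ z ∈ K v w, z ∉ S := fun v w z hz => notMem_of_mem_sector_inter hCS hz
  have hanchor : ∀ v w u, P.boundaryGraph.Adj v w → (u = v ∨ u = w) →
      P.base + ε • ((u : ℂ) - P.base) ∈ T v w ∩ K v w ∧ (u : ℂ) ∈ T v w := by
    intro v w u h hu
    have hus : (u : ℂ) ∈ segment ℝ (v : ℂ) w := by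
      rcases hu with rfl | rfl
      exacts [left_mem_segment ℝ _ _, right_mem_segment ℝ _ _]
    exact ⟨⟨Splitting.ray_mem_sector h hus hε0 hε1, Splitting.ray_mem_sector h hus hε0 trivial,
      hεC u⟩, Splitting.mem_sector_of_mem_boundary Set.self_mem_Iic
        (Splitting.segment_subset_boundary h hus) hus⟩
  have hanchorS : ∀ u : vertices (sites S θ), P.base + ε • ((u : ℂ) - P.base) ∉ S := by
    intro u hu
    have := hCS _ (hεC u) hu
    rw [hbase, add_eq_left, smul_eq_zero] at this
    rcases this with h | h
    · exact hε0.ne' h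
    · exact vertex_notMem u (Or.inl (sub_eq_zero.mp h ▸ s.2))
  let α : vertices (sites S θ) → Punctured S := fun u => ⟨_, hanchorS u⟩
  -- The value from a vertex to its anchor does not depend on the sector: the segment between them
  -- lies in every `T` over an edge at `u`.
  have hδ : ∀ u : vertices (sites S θ), ∃ m : A, ∀ v w, P.boundaryGraph.Adj v w →
      (u = v ∨ u = w) → ∀ p : Path (point u) (α u), (∀ t, (p t : ℂ) ∈ T v w) → q.val p = m := by
    intro u
    by_cases hex : ∃ v w, P.boundaryGraph.Adj v w ∧ (u = v ∨ u = w)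
    · obtain ⟨v, w, h, hu⟩ := hex
      have ha := hanchor v w u h hu
      let p₀ : Path (point u) (α u) := segmentPath _ _ fun z hz =>
        hTS v w z ((hTconv v w h).segment_subset ha.2 ha.1.1 hz)
      refine ⟨q.val p₀, fun v' w' h' hu' p hp => ?_⟩
      have ha' := hanchor v' w' u h' hu'
      exact q.homotopic (homotopic_of_convex (hTconv v' w' h') (hTS v' w') _ _ hp fun t =>
        (hTconv v' w' h').segment_subset ha'.2 ha'.1.1 (segmentPath_mem (point u) (α u) _ t))
    · exact ⟨0, fun v w h hu => absurd ⟨v, w, h, hu⟩ hex⟩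
  choose m hm using hδ
  let f' : vertices (sites S θ) → A := fun u => f u + m u
  have hedge : ∀ v w, P.boundaryGraph.Adj v w → ∀ p : Path (α v) (α w),
      (∀ t, (p t : ℂ) ∈ T v w) → q.val p = f' w - f' v := by
    intro v w h p hp
    have hv := hanchor v w v h (Or.inl rfl)
    have hw := hanchor v w w h (Or.inr rfl)
    obtain ⟨dv, hdv⟩ := exists_path_of_convex (x := point v) (y := α v) (hTconv v w h) (hTS v w)
      hv.2 hv.1.1
    obtain ⟨dw, hdw⟩ := exists_path_of_convex (x := point w) (y := α w) (hTconv v w h) (hTS v w)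
      hw.2 hw.1.1
    have hadj : (voronoi S θ).Adj v w := P.boundaryGraph_le h
    have h1 : q.val (dv.trans p) = q.val ((edgePath hadj).trans dw) :=
      q.homotopic (homotopic_of_convex (hTconv v w h) (hTS v w) _ _ (trans_mem hdv hp)
        (trans_mem (fun t => (hTconv v w h).segment_subset hv.2 hw.2 (edgePath_mem hadj t)) hdw))
    rw [q.trans, q.trans, hf _ _ hadj (hedges v w h), hm v v w h (Or.inl rfl) dv hdv,
      hm w v w h (Or.inr rfl) dw hdw] at h1
    simp only [f']
    rw [← sub_eq_zero] at h1 ⊢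
    rw [← h1]
    abel
  -- Within one sector either anchor may serve as the starting point. The path between anchors is
  -- taken in `T ∩ K`: in `T` its value is known, in `K` it can be compared.
  have hmove : ∀ v w u, P.boundaryGraph.Adj v w → (u = v ∨ u = w) → ∀ x : Punctured S,
      ∀ (η : Path (α v) x) (ζ : Path (α u) x), (∀ t, (η t : ℂ) ∈ K v w) →
      (∀ t, (ζ t : ℂ) ∈ K v w) → f' u + q.val ζ = f' v + q.val η := by
    intro v w u h hu x η ζ hη hζ
    rcases hu with rfl | rfl
    · rw [q.homotopic (homotopic_of_convex (hKconv u w h) (hKS u w) _ _ hη hζ)]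
    · have hv := hanchor v u v h (Or.inl rfl)
      have hw := hanchor v u u h (Or.inr rfl)
      obtain ⟨p, hp⟩ := exists_path_of_convex (x := α v) (y := α u)
        ((hTconv v u h).inter (hKconv v u h)) (fun z hz => hTS v u z hz.1) hv.1 hw.1
      have h1 := q.homotopic (homotopic_of_convex (hKconv v u h) (hKS v u) η (p.trans ζ) hη
        (trans_mem (fun t => (hp t).2) hζ))
      rw [h1, q.trans, hedge v u h p fun t => (hp t).1]
      abel
  have huniq : ∀ x : Punctured S, ∃ g : A, ∀ v w, P.boundaryGraph.Adj v w →
      ∀ η : Path (α v) x, (∀ t, (η t : ℂ) ∈ K v w) → g = f' v + q.val η := by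
    intro x
    by_cases hex : ∃ v w, P.boundaryGraph.Adj v w ∧
      ∃ η : Path (α v) x, ∀ t, (η t : ℂ) ∈ K v w
    · obtain ⟨v, w, h, η, hη⟩ := hex
      refine ⟨f' v + q.val η, fun v' w' h' η' hη' => ?_⟩
      have hx : (x : ℂ) ∈ K v w := by simpa using hη 1
      have hx' : (x : ℂ) ∈ K v' w' := by simpa using hη' 1
      obtain ⟨u, hu, hu'⟩ := exists_common_endpoint (P.boundaryGraph_le h) (P.boundaryGraph_le h')
        hx.1.2.2 hx'.1.2.2
      obtain ⟨ζ, hζ⟩ := exists_path_of_convex (x := α u) (y := x)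
        ((hKconv v w h).inter (hKconv v' w' h')) (fun z hz => hKS v w z hz.1)
        ⟨(hanchor v w u h hu).1.2, (hanchor v' w' u h' hu').1.2⟩ ⟨hx, hx'⟩
      rw [← hmove v w u h hu x η ζ hη fun t => (hζ t).1,
        ← hmove v' w' u h' hu' x η' ζ hη' fun t => (hζ t).2]
    · exact ⟨0, fun v w h η hη => absurd ⟨v, w, h, η, hη⟩ hex⟩
  choose g hg using huniq
  refine ⟨g, fun x y p hp => q.eq_sub_of_local {x | (x : ℂ) ∈ C} g ?_ p hp⟩
  intro x hx
  have hxb : (x : ℂ) ≠ P.base := fun h => x.2 (h ▸ s.2)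
  have hloc : ∀ᶠ y in 𝓝 (x : ℂ), (y ∈ C ∧ y ∉ S) ∧ ∀ a : vertices (sites S θ) ×
      vertices (sites S θ), (x : ℂ) ∉ P.sector Set.univ a.1 a.2 →
      y ∉ P.sector Set.univ a.1 a.2 := by
    have h1 : ∀ᶠ y in 𝓝 (x : ℂ), y ∈ C := hCo.mem_nhds hx
    have h2 : ∀ᶠ y in 𝓝 (x : ℂ), y ∉ S := S.finite_toSet.isClosed.isOpen_compl.mem_nhds x.2
    refine (h1.and h2).and ?_
    rw [Filter.eventually_all]
    intro a
    by_cases hxa : (x : ℂ) ∈ P.sector Set.univ a.1 a.2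
    · exact Filter.Eventually.of_forall fun y h => absurd hxa h
    · exact (Splitting.eventually_notMem_sector isClosed_univ hxb hxa).mono fun y hy _ => hy
  obtain ⟨r, hr, hball⟩ := Metric.eventually_nhds_iff_ball.mp hloc
  refine ⟨Subtype.val ⁻¹' Metric.ball (x : ℂ) r,
    continuous_subtype_val.continuousAt (Metric.ball_mem_nhds _ hr), fun y hy δ hδ => ?_⟩
  have hyb : (y : ℂ) ≠ P.base := fun h => y.2 (h ▸ s.2)
  obtain ⟨v, w, h, hyv⟩ := Splitting.exists_sector (K := Set.univ) hyb trivial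
  have hxv : (x : ℂ) ∈ P.sector Set.univ v w := by
    by_contra hxv
    exact (hball y hy).2 (v, w) hxv hyv
  have hxK : (x : ℂ) ∈ K v w := ⟨hxv, hx⟩
  have hyK : (y : ℂ) ∈ K v w := ⟨hyv, (hball y hy).1.1⟩
  obtain ⟨η, hη⟩ := exists_path_of_convex (x := α v) (y := x) (hKconv v w h) (hKS v w)
    (hanchor v w v h (Or.inl rfl)).1.2 hxK
  obtain ⟨δ', hδ'⟩ := exists_path_of_convex (x := x) (y := y)
    ((hKconv v w h).inter (convex_ball (x : ℂ) r)) (fun z hz => hKS v w z hz.1)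
    ⟨hxK, Metric.mem_ball_self hr⟩ ⟨hyK, hy⟩
  have h1 : q.val δ = q.val δ' := q.homotopic (homotopic_of_convex (convex_ball (x : ℂ) r)
    (fun z hz => (hball z hz).1.2) _ _ hδ fun t => (hδ' t).2)
  rw [h1, hg x v w h η hη, hg y v w h (η.trans δ') (trans_mem hη fun t => (hδ' t).1), q.trans]
  abel

/-- In the setting of convex open sets with at most one puncture, path invariants depend on
endpoints only, provided that they vanish on the boundary cycles of the cells. -/
theorem val_eq_of_convex (hS : 2 ≤ S.card) (q : PathInvariant (Punctured S) A)
    (hq : ∀ s : S, ∃ (v₀ : vertices (sites S θ)) (c : (voronoi S θ).Walk v₀ v₀), c.IsCycle ∧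
      q.val (walkPath c) = 0 ∧
      ∀ a b, (siteSplitting hS θ s).boundaryGraph.Adj a b → s(a, b) ∈ c.edges)
    {C : Set ℂ} (hC : Convex ℝ C) (hCo : IsOpen C) (hCS : (C ∩ S).Subsingleton)
    {x y : Punctured S} (p p' : Path x y) (hp : ∀ t, (p t : ℂ) ∈ C)
    (hp' : ∀ t, (p' t : ℂ) ∈ C) : q.val p = q.val p' := by
  by_cases hex : ∃ s ∈ S, s ∈ C
  · obtain ⟨s, hs, hsC⟩ := hex
    obtain ⟨v₀, c, hc, hqc, hedges⟩ := hq ⟨s, hs⟩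
    obtain ⟨g, hg⟩ := exists_potential_of_cycle hS q ⟨s, hs⟩ hc hqc hedges hC hCo hsC
      fun z hz hzS => hCS ⟨hz, hzS⟩ ⟨hsC, hs⟩
    rw [hg _ _ p hp, hg _ _ p' hp']
  · push Not at hex
    exact q.homotopic (homotopic_of_convex hC (fun z hz hzS => hex z hzS hz) p p' hp hp')

end Potentials

/-! ### Potentials on the whole of `ℂ - S`, and generation of the two groups -/

section Generation

open Topology

variable {S : Finset ℂ} {θ : ℝ} {A : Type} [AddCommGroup A]

theorem notMem_segment_add_mul_I {x y s : ℂ} {r : ℝ} (hr : r ≠ 0) (hs : s ∈ segment ℝ x y)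
    (hsx : s ≠ x) : s ∉ segment ℝ x (s + r * (Complex.I * (y - x))) := by
  rw [segment_eq_image_lineMap] at hs ⊢
  obtain ⟨b, -, hb⟩ := hs
  rintro ⟨a, -, ha⟩
  rw [AffineMap.lineMap_apply_module'] at ha hb
  rw [Complex.real_smul] at ha hb
  have hd : y - x ≠ 0 := fun h => hsx (by rw [← hb, h]; simp)
  have h : (a * (b + r * Complex.I) - b : ℂ) * (y - x) = 0 := by
    rw [← hb] at ha
    linear_combination ha
  have h' := (mul_eq_zero.mp h).resolve_right hd
  have him := congrArg Complex.im h'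
  have hre := congrArg Complex.re h'
  simp [hr] at him hre
  subst him
  apply hsx
  rw [← hb, show b = 0 by simpa using hre]
  simp

/-- If the puncture lies on the segment, go around it through a nearby point `z` off the line. -/
theorem exists_path_of_subsingleton {C : Set ℂ} (hC : Convex ℝ C) (hCo : IsOpen C)
    (hCS : (C ∩ S).Subsingleton) {x y : Punctured S} (hx : (x : ℂ) ∈ C) (hy : (y : ℂ) ∈ C) :
    ∃ p : Path x y, ∀ t, (p t : ℂ) ∈ C := by
  by_cases hex : ∃ s ∈ segment ℝ (x : ℂ) y, s ∈ S
  · obtain ⟨s, hs, hsS⟩ := hex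
    have hsC := hC.segment_subset hx hy hs
    have hsx : s ≠ x := fun h => x.2 (h ▸ hsS)
    have hsy : s ≠ y := fun h => y.2 (h ▸ hsS)
    obtain ⟨r, hr, hrC⟩ : ∃ r : ℝ, r ≠ 0 ∧ s + r * (Complex.I * (y - x)) ∈ C := by
      have h1 : ∀ᶠ r : ℝ in 𝓝[≠] 0, s + r * (Complex.I * ((y : ℂ) - x)) ∈ C := by
        have hcont : Continuous fun r : ℝ => s + r * (Complex.I * ((y : ℂ) - x)) := by fun_prop
        exact nhdsWithin_le_nhds (hcont.continuousAt.preimage_mem_nhds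
          (hCo.mem_nhds (by simpa using hsC)))
      obtain ⟨r, h1, h2⟩ := (h1.and self_mem_nhdsWithin).exists
      exact ⟨r, h2, h1⟩
    set z := s + r * (Complex.I * (y - x)) with hz
    have h1 : s ∉ segment ℝ (x : ℂ) z := notMem_segment_add_mul_I hr hs hsx
    have h2 : s ∉ segment ℝ z (y : ℂ) := by
      -- Seen from `y` the direction of the segment is reversed, hence the sign of `r`.
      have := notMem_segment_add_mul_I (neg_ne_zero.mpr hr) (segment_symm ℝ (x : ℂ) y ▸ hs) hsy
      rw [segment_symm, hz]
      convert this using 3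
      push_cast
      ring
    have hsub : ∀ u ∈ C, u ∈ S → u = s := fun u hu huS => hCS ⟨hu, huS⟩ ⟨hsC, hsS⟩
    have hzS : z ∉ S := fun h => h1 (hsub z hrC h ▸ right_mem_segment ℝ _ _)
    obtain ⟨p, hp⟩ := exists_path_of_convex (x := x) (y := (⟨z, hzS⟩ : Punctured S))
      (convex_segment (x : ℂ) z)
      (fun u hu huS => h1 (hsub u (hC.segment_subset hx hrC hu) huS ▸ hu))
      (left_mem_segment ℝ _ _) (right_mem_segment ℝ _ _)
    obtain ⟨p', hp'⟩ := exists_path_of_convex (x := (⟨z, hzS⟩ : Punctured S)) (y := y)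
      (convex_segment z (y : ℂ))
      (fun u hu huS => h2 (hsub u (hC.segment_subset hrC hy hu) huS ▸ hu))
      (left_mem_segment ℝ _ _) (right_mem_segment ℝ _ _)
    exact ⟨p.trans p', trans_mem (fun t => hC.segment_subset hx hrC (hp t))
      fun t => hC.segment_subset hrC hy (hp' t)⟩
  · push Not at hex
    obtain ⟨p, hp⟩ := exists_path_of_convex (convex_segment (x : ℂ) y) hex
      (left_mem_segment ℝ _ _) (right_mem_segment ℝ _ _)
    exact ⟨p, fun t => hC.segment_subset hx hy (hp t)⟩

/-- A point from which the points of `S` are seen in different directions. -/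
theorem exists_generic (S : Finset ℂ) :
    ∃ p : Punctured S, ∀ x : ℂ, (segment ℝ (p : ℂ) x ∩ S).Subsingleton := by
  have hline : ∀ s t : ℂ, MeasureTheory.volume (line[ℝ, s, t] : Set ℂ) = 0 := by
    intro s t
    refine MeasureTheory.Measure.addHaar_affineSubspace _ _ fun h => ?_
    have h1 := collinear_iff_finrank_le_one.mp (collinear_pair ℝ s t)
    rw [← direction_affineSpan, h, AffineSubspace.direction_top, finrank_top,
      Complex.finrank_real_complex] at h1
    omega
  -- Lines are null sets. The case `s = t` is included and gives `p ∉ S`.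
  obtain ⟨p, hp⟩ : ∃ p : ℂ, ∀ s ∈ S, ∀ t ∈ S, p ∉ line[ℝ, s, t] := by
    have : ∀ᵐ p : ℂ, ∀ s ∈ S, ∀ t ∈ S, p ∉ line[ℝ, s, t] := by
      rw [Finset.eventually_all]
      intro s _
      rw [Finset.eventually_all]
      intro t _
      exact MeasureTheory.measure_eq_zero_iff_ae_notMem.mp (hline s t)
    exact this.exists
  refine ⟨⟨p, fun h => hp p h p h (left_mem_affineSpan_pair ℝ p p)⟩, fun x s hs t ht => ?_⟩
  by_contra hst
  obtain ⟨hs, hsS⟩ := hs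
  obtain ⟨ht, htS⟩ := ht
  rw [segment_eq_image_lineMap] at hs ht
  obtain ⟨a, -, ha⟩ := hs
  obtain ⟨b, -, hb⟩ := ht
  have hab : a - b ≠ 0 := fun h => hst (by rw [← ha, ← hb, sub_eq_zero.mp h])
  apply hp s hsS t htS
  have hk : AffineMap.lineMap s t (a / (a - b)) = p := by
    rw [← ha, ← hb]
    simp only [AffineMap.lineMap_apply_module', Complex.real_smul]
    have : ((a : ℂ) - b) ≠ 0 := by exact_mod_cast hab
    push_cast
    field_simp
    ring
  rw [← hk]
  exact AffineMap.lineMap_mem_affineSpan_pair _ _ _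

/-- The finitely many points of `S` off the compact segment have positive distance from it. -/
theorem exists_thickening_subsingleton {p x : ℂ} (h : (segment ℝ p x ∩ S).Subsingleton) :
    ∃ δ : ℝ, 0 < δ ∧ (Metric.thickening δ (segment ℝ p x) ∩ S).Subsingleton := by
  have hcomp : IsCompact (segment ℝ p x) := by
    rw [segment_eq_image_lineMap]
    exact isCompact_Icc.image AffineMap.lineMap_continuous
  obtain ⟨δ, hδ, hsub⟩ := hcomp.exists_thickening_subset_open
    (t := ((S : Set ℂ) \ segment ℝ p x)ᶜ) (S.finite_toSet.subset Set.sdiff_subset).isClosed.isOpen_compl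
    fun z hz hz' => hz'.2 hz
  refine ⟨δ, hδ, h.anti fun z hz => ⟨?_, hz.2⟩⟩
  by_contra hzn
  exact hsub hz.1 ⟨hz.2, hzn⟩

/-- A path invariant that vanishes on the boundary cycles of the cells depends on endpoints
only. -/
theorem exists_potential (hS : 2 ≤ S.card) (q : PathInvariant (Punctured S) A)
    (hq : ∀ s : S, ∃ (v₀ : vertices (sites S θ)) (c : (voronoi S θ).Walk v₀ v₀), c.IsCycle ∧
      q.val (walkPath c) = 0 ∧
      ∀ a b, (siteSplitting hS θ s).boundaryGraph.Adj a b → s(a, b) ∈ c.edges) :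
    ∃ g : Punctured S → A, ∀ (x y : Punctured S) (p : Path x y), q.val p = g y - g x := by
  obtain ⟨o, ho⟩ := exists_generic S
  choose δ hδ hsub using fun x : Punctured S => exists_thickening_subsingleton (ho (x : ℂ))
  let C : Punctured S → Set ℂ := fun x => Metric.thickening (δ x) (segment ℝ (o : ℂ) x)
  have hC : ∀ x, Convex ℝ (C x) := fun x => (convex_segment _ _).thickening _
  have hCo : ∀ x, IsOpen (C x) := fun x => Metric.isOpen_thickening
  have hoC : ∀ x, (o : ℂ) ∈ C x := fun x =>
    Metric.self_subset_thickening (hδ x) _ (left_mem_segment ℝ _ _)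
  have hxC : ∀ x, (x : ℂ) ∈ C x := fun x =>
    Metric.self_subset_thickening (hδ x) _ (right_mem_segment ℝ _ _)
  choose η hη using fun x : Punctured S =>
    exists_path_of_subsingleton (hC x) (hCo x) (hsub x) (hoC x) (hxC x)
  refine ⟨fun x => q.val (η x), fun x y p =>
    q.eq_sub_of_local Set.univ (fun x => q.val (η x)) ?_ p fun _ => trivial⟩
  intro x _
  refine ⟨Subtype.val ⁻¹' C x, continuous_subtype_val.continuousAt ((hCo x).mem_nhds (hxC x)),
    fun y hy ζ hζ => ?_⟩
  -- `C x ∩ C y` is again convex and open with at most one puncture; a path from `o` to `y` in it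
  -- can be compared with `η y` in `C y` and with `η x` followed by `ζ` in `C x`.
  obtain ⟨ξ, hξ⟩ := exists_path_of_subsingleton ((hC x).inter (hC y)) ((hCo x).inter (hCo y))
    ((hsub x).anti fun z hz => ⟨hz.1.1, hz.2⟩) ⟨hoC x, hoC y⟩ ⟨hy, hxC y⟩
  have h1 : q.val ξ = q.val (η y) := val_eq_of_convex hS q hq (hC y) (hCo y) (hsub y) _ _
    (fun t => (hξ t).2) (hη y)
  have h2 : q.val ξ = q.val ((η x).trans ζ) := val_eq_of_convex hS q hq (hC x) (hCo x) (hsub x)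
    _ _ (fun t => (hξ t).1) (trans_mem (hη x) hζ)
  rw [q.trans] at h2
  rw [← h1, h2]
  abel

/-- The path invariant with values in the singular `1`-chains modulo boundaries and modulo the
classes of given loops. -/
def quotientInvariant {X : Type} [TopologicalSpace X] (N : Submodule ℤ (Opcycles X)) :
    PathInvariant X (Opcycles X ⧸ N) where
  val γ := N.mkQ (pathClass γ)
  homotopic h := by rw [pathClass_homotopic h]
  trans p p' := by rw [pathClass_trans, map_add]

/-- Apply `exists_potential` to the class of a path modulo all the cycles. The cycles around the
points of `S` already yield the potential; the outer one merely enlarges the span. -/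
theorem span_loopClass_boundaryCycles (hS : 2 ≤ S.card) {b : OnePoint S → vertices (sites S θ)}
    {c : ∀ i, (voronoi S θ).Walk (b i) (b i)} (hc : ∀ i, (c i).IsCycle)
    (hedges : ∀ i a a', (regionSplitting hS θ i).boundaryGraph.Adj a a' → s(a, a') ∈ (c i).edges) :
    Submodule.span ℤ (Set.range fun i => loopClass (walkPath (c i))) =
      (⊤ : Submodule ℤ (H1 (Punctured S))) := by
  set N := Submodule.span ℤ (Set.range fun i => pathClass (walkPath (c i))) with hN
  obtain ⟨g, hg⟩ := exists_potential (θ := θ) hS (quotientInvariant N) fun s =>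
    ⟨b (OnePoint.some s), c (OnePoint.some s), hc _, (Submodule.Quotient.mk_eq_zero N).mpr
      (Submodule.subset_span ⟨OnePoint.some s, rfl⟩), hedges (OnePoint.some s)⟩
  exact span_loopClass_eq_top (hA := Submodule.Quotient.module N) (fun i => walkPath (c i)) N.mkQ (Submodule.ker_mkQ N).le g
    fun y z δ => hg y z δ

theorem closure_walkPath_eq_top (hS : 2 ≤ S.card) (v : vertices (sites S θ)) :
    Subgroup.closure (Set.range fun c : (voronoi S θ).Walk v v =>
      (FundamentalGroup.fromPath ⟦walkPath c⟧ :
        FundamentalGroup (Punctured S) (point v))) = ⊤ := by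
  refine eq_top_iff.mpr fun x _ => Subgroup.subset_closure ?_
  obtain ⟨p, hp⟩ := Quotient.exists_rep (FundamentalGroup.toPath x)
  obtain ⟨c, hc⟩ := isWalkClass_all hS p
  exact ⟨c, congrArg FundamentalGroup.fromPath (hc.trans hp)⟩

end Generation

end VoronoiCycles

end

theorem mainTheorem3 (S : Finset ℂ) (hS : 2 ≤ S.card) (θ : ℝ) :
    (∃ (b : OnePoint S → VoronoiCycles.vertices (VoronoiCycles.sites S θ))
        (c : ∀ s : OnePoint S, (VoronoiCycles.voronoi S θ).Walk (b s) (b s)),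
      (∀ s : OnePoint S, VoronoiCycles.IsBoundaryCycle (VoronoiCycles.region S θ s) (c s)) ∧
      Submodule.span ℤ
          (Set.range fun s : OnePoint S => VoronoiCycles.loopClass (VoronoiCycles.walkPath (c s))) =
        (⊤ : Submodule ℤ (VoronoiCycles.H1 (VoronoiCycles.Punctured S)))) ∧
    (∀ v : VoronoiCycles.vertices (VoronoiCycles.sites S θ),
      Subgroup.closure
          (Set.range fun c : (VoronoiCycles.voronoi S θ).Walk v v =>
            (FundamentalGroup.fromPath ⟦VoronoiCycles.walkPath c⟧ :
              FundamentalGroup (VoronoiCycles.Punctured S) (VoronoiCycles.point v))) =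
        ⊤) := by
  choose b c hc hrange hedges using fun i : OnePoint S =>
    (VoronoiCycles.regionSplitting hS θ i).exists_boundary_cycle
  exact ⟨⟨b, c, fun i => ⟨hc i, (hrange i).trans (VoronoiCycles.frontier_region hS θ i).symm⟩,
    VoronoiCycles.span_loopClass_boundaryCycles hS hc hedges⟩,
    VoronoiCycles.closure_walkPath_eq_top hS⟩
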